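/- An \emph{$n$-ary Boolean function} is a map $\{0,1\}^n\to\{0,1\}$; a \emph{Boolean function family} is a sequence $(f_n)_{n\in\mathbb N}$ with $f_n$ an $n$-ary Boolean function. Such a family is identified with the unique $f:\{0,1\}^*\to\{0,1\}$ with $f(w)=f_n(w)$ for all $n$ and $w\in\{0,1\}^n$. Let $\mathrm{poly}$ be the set of all $h:\mathbb N\to\mathbb N$ with $h(n)=O(n^k)$ for some $k\in\mathbb N$. \textbf{Instruction sequences.} There are Boolean registers $\mathrm{in}{:}1,\mathrm{in}{:}2,\dots$, $\mathrm{aux}{:}1,\mathrm{aux}{:}2,\dots$ and $\mathrm{out}$. The basic instructions are $r.\mathrm{get}$ for an input or auxiliary register $r$ (the reply is the contents of $r$) and $r.\mathrm{set}{:}b$ for an auxiliary register or the output register $r$ and $b\in\{0,1\}$ (the contents becomes $b$ and the reply is $b$). A (single-pass) instruction sequence is a non-empty finite sequence of primitive instructions: for a basic instruction $a$, the plain instruction $a$ (perform $a$ and go to the next instruction), the positive test $+a$ (perform $a$ and go to the next instruction on reply $1$, skip the next instruction on reply $0$), the negative test $-a$ (the same with the replies interchanged); forward jumps $\#l$, $l\in\mathbb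 N$ (go to the $l$-th next instruction); and the termination instruction $!$. If $l=0$, or if there is no instruction to proceed with, execution becomes inactive and never terminates. An instruction sequence $X$ \emph{computes} $f:\{0,1\}^n\to\{0,1\}$ if there is an $l\in\mathbb N$ such that, for all $b_1,\dots,b_n\in\{0,1\}$, the execution of $X$, started with the registers $\mathrm{in}{:}i$ containing $b_i$ ($1\le i\le n$) and the registers $\mathrm{aux}{:}1,\dots,\mathrm{aux}{:}l$ and $\mathrm{out}$ containing $0$, performs basic instructions on these registers only and terminates with $f(b_1,\dots,b_n)$ in $\mathrm{out}$. \textbf{The class NPLIS.} $\mathrm{PLIS}$ is the class of all Boolean function families $(f_n)$ for which there is an $h\in\mathrm{poly}$ such that, for every $n$, some instruction sequence of length at most $h(n)$ computes $f_n$. $\mathrm{NPLIS}$ is the class of all Boolean function families $(f_n)$ for which there are a monotone (non-decreasing) $h\in\mathrm{poly}$ and a family $(g_n)\in\mathrm{PLIS}$ such that, for all $n\in\mathbb N$ and $w\in\{0,1\}^n$, $$f_n(w)=1\iff \exists\, c\in\{0,1\}^{h(n)}:\ g_{n+h(n)}(wc)=1 .$$ \textbf{The class NP/poly.} For $w=b_1\cdots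 b_n$ and $c$ in $\{0,1\}^*$ let $\langle w,c\rangle=b_1b_1\cdots b_nb_n\,1\,0\,c$. Let $\mathrm P$ be the class of functions $\{0,1\}^*\to\{0,1\}$ computable in polynomial time by a deterministic Turing machine; let $\mathrm{NP}$ be the class of all $f:\{0,1\}^*\to\{0,1\}$ for which there are a polynomial $p$ with coefficients in $\mathbb N$ and a $g\in\mathrm P$ such that $f(w)=1\iff\exists\,c\in\{0,1\}^{p(|w|)}:\ g(\langle w,c\rangle)=1$ for all $w$; and let $\mathrm{NP/poly}$ be the class of all $f:\{0,1\}^*\to\{0,1\}$ for which there are a $g\in\mathrm{NP}$ and an advice function $a:\mathbb N\to\{0,1\}^*$ with $|a(n)|\le h(n)$ for all $n$ and some $h\in\mathrm{poly}$, such that $f(w)=g(\langle w,a(|w|)\rangle)$ for all $w\in\{0,1\}^*$. \textbf{Theorem.} Under the identification of Boolean function families with functions $\{0,1\}^*\to\{0,1\}$, $\mathrm{NPLIS}=\mathrm{NP/poly}$. -/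

import Mathlib

namespace InSeq

/-! ### Instruction sequences acting on Boolean registers -/

/-- Foci, the names of Boolean registers. Indices start at `0`: `inp i` and `aux i` name the
`(i+1)`-th input register and the `(i+1)`-th auxiliary register. -/
inductive Focus
  | inp (i : ℕ)
  | aux (i : ℕ)
  | out
deriving DecidableEq

/-- Methods of Boolean registers. -/
inductive Method
  | set (b : Bool)
  | get
deriving DecidableEq

/-- A basic instruction (equivalently, a basic action) `f.m`. -/
structure BasicInstr where
  focus : Focus
  method : Method
deriving DecidableEq

/-- Primitive instructions: plain basic instructions, positive and negative tests, forward jumps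
and termination. -/
inductive Instr
  | basic (a : BasicInstr)
  | ptst (a : BasicInstr)
  | ntst (a : BasicInstr)
  | fjmp (l : ℕ)
  | halt
deriving DecidableEq

/-- Finite threads. `tau x` performs the internal action and proceeds as `x`; since the reply to
the internal action is always positive, it needs only one continuation. `pcc x a y` performs `a`
and proceeds as `x` on reply `true` and as `y` on reply `false`. -/
inductive Thread
  | inaction
  | terminated
  | tau (x : Thread)
  | pcc (x : Thread) (a : BasicInstr) (y : Thread)

/-- Auxiliary termination measure for thread extraction. -/
def extrMeasure : List Instr → ℕ
  | [] => 0
  | .ptst _ :: X => 2 * X.length + 3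
  | .ntst _ :: X => 2 * X.length + 3
  | _ :: X => 2 * X.length + 2

theorem extrMeasure_le (X : List Instr) : extrMeasure X ≤ 2 * X.length + 1 := by
  rcases X with _ | ⟨u, X⟩
  · simp [extrMeasure]
  · cases u <;> simp [extrMeasure] <;> omega

/-- Thread extraction: the behaviour produced by a finite sequence of instructions. The empty
sequence, which is not an instruction sequence, stands for the absence of an instruction to proceed
with. -/
def extr : List Instr → Thread
  | [] => .inaction
  | .basic a :: X => .pcc (extr X) a (extr X)
  | .ptst a :: X => .pcc (extr X) a (extr (.fjmp 2 :: X))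
  | .ntst a :: X => .pcc (extr (.fjmp 2 :: X)) a (extr X)
  | .fjmp 0 :: _ => .inaction
  | .fjmp 1 :: X => extr X
  | .fjmp (_ + 2) :: [] => .inaction
  | .fjmp (l + 2) :: _ :: X => extr (.fjmp (l + 1) :: X)
  | .halt :: _ => .terminated
termination_by X => extrMeasure X
decreasing_by
  all_goals
    first
    | exact lt_of_le_of_lt (extrMeasure_le X) (by simp only [extrMeasure]; omega)
    | (simp only [extrMeasure, List.length_cons]; omega)

/-- Services: the empty service and the Boolean registers with their contents. -/
inductive Service
  | empty
  | BR (b : Bool)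
deriving DecidableEq

/-- The service that results from processing a method. -/
def Service.derive : Method → Service → Service
  | _, .empty => .empty
  | .set b, .BR _ => .BR b
  | .get, .BR b => .BR b

/-- The reply to a request to process a method; `none` stands for a blocked request. -/
def Service.reply : Method → Service → Option Bool
  | _, .empty => none
  | .set b, .BR _ => some b
  | .get, .BR b => some b

/-- The use operator: the thread that results if the service named `f`, initially `S`, processes
all the requests made to it. -/
def Thread.use (f : Focus) : Thread → Service → Thread
  | .terminated, _ => .terminated
  | .inaction, _ => .inaction
  | .tau x, S => .tau (x.use f S)
  | .pcc x a y, S =>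
    if a.focus = f then
      match S.reply a.method with
      | some true => .tau (x.use f (S.derive a.method))
      | some false => .tau (y.use f (S.derive a.method))
      | none => .tau .inaction
    else .pcc (x.use f S) a (y.use f S)

/-- The apply operator: the service that results from `S`, named `f`, on termination. -/
def Thread.apply (f : Focus) : Thread → Service → Service
  | .terminated, S => S
  | .inaction, _ => .empty
  | .tau x, S => x.apply f S
  | .pcc x a y, S =>
    if a.focus = f then
      match S.reply a.method with
      | some true => x.apply f (S.derive a.method)
      | some false => y.apply f (S.derive a.method)
      | none => .empty
    else .empty

/-- The thread `t` using the first `l` auxiliary registers, all with initial contents `false`. -/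
def useAux (l : ℕ) (t : Thread) : Thread :=
  (List.range l).foldl (fun t j => t.use (.aux j) (.BR false)) t

/-- The thread `t` using the first `n` input registers, with contents `b`. -/
def useInp {n : ℕ} (b : Fin n → Bool) (t : Thread) : Thread :=
  (List.finRange n).foldl (fun t (i : Fin n) => t.use (.inp i) (.BR (b i))) t

/-- `X` computes the `n`-ary Boolean function `f`. -/
def Computes {n : ℕ} (X : List Instr) (f : (Fin n → Bool) → Bool) : Prop :=
  ∃ l : ℕ, ∀ b : Fin n → Bool,
    (useInp b (useAux l (extr X))).apply .out (.BR false) = .BR (f b)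

/-- Basic instructions permitted in instruction sequences: input registers can only be read, the
output register can only be written. -/
def BasicInstr.Permitted : BasicInstr → Prop
  | ⟨.inp _, .get⟩ => True
  | ⟨.inp _, .set _⟩ => False
  | ⟨.aux _, _⟩ => True
  | ⟨.out, .set _⟩ => True
  | ⟨.out, .get⟩ => False

/-- Primitive instructions built from permitted basic instructions. -/
def Instr.Permitted : Instr → Prop
  | .basic a => a.Permitted
  | .ptst a => a.Permitted
  | .ntst a => a.Permitted
  | .fjmp _ => True
  | .halt => True

/-- The non-empty finite instruction sequences acting on Boolean registers. -/
def ISbr : Set (List Instr) :=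
  {X | X ≠ [] ∧ ∀ u ∈ X, u.Permitted}

/-! ### Non-uniform complexity classes -/

/-- A Boolean function family has an `n`-ary Boolean function for each `n`. -/
abbrev BoolFamily := (n : ℕ) → (Fin n → Bool) → Bool

/-- Identification of Boolean function families with functions from bit strings to `Bool`:
`f w = fₙ w` for each string `w` of length `n`. -/
def familyEquiv : BoolFamily ≃ (List Bool → Bool) where
  toFun F w := F w.length w.get
  invFun f n w := f (List.ofFn w)
  left_inv F := by
    have key : ∀ (m n : ℕ) (v : Fin m → Bool) (w : Fin n → Bool) (h : m = n),
        (∀ i : Fin m, v i = w (Fin.cast h i)) → F m v = F n w := by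
      rintro m n v w rfl h
      exact congrArg _ (funext h)
    funext n w
    exact key _ _ _ _ List.length_ofFn (fun i => by simp [Fin.cast])
  right_inv f := by
    funext w
    simp

/-- The functions `h : ℕ → ℕ` with `h n = O(n ^ k)` for some `k`. -/
def poly : Set (ℕ → ℕ) :=
  {h | ∃ k : ℕ, (fun n => (h n : ℝ)) =O[Filter.atTop] fun n => (n : ℝ) ^ k}

/-- The families computed by instruction sequences from `IS` of lengths bounded by a function
from `F`. -/
def nuc (IS : Set (List Instr)) (F : Set (ℕ → ℕ)) : Set BoolFamily :=
  {f | ∃ h ∈ F, ∀ n, ∃ X ∈ IS, Computes X (f n) ∧ X.length ≤ h n}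

/-- The families with certificates of monotone length from `F` that are checked by a family from
`nuc IS F`. -/
def ndnuc (IS : Set (List Instr)) (F : Set (ℕ → ℕ)) : Set BoolFamily :=
  {f | ∃ h ∈ F, Monotone h ∧ ∃ g ∈ nuc IS F, ∀ (n : ℕ) (w : Fin n → Bool),
    f n w = true ↔ ∃ c : Fin (h n) → Bool, g (n + h n) (Fin.append w c) = true}

/-- Families computed by polynomial-length instruction sequences. -/
def PLIS : Set BoolFamily := nuc ISbr poly

/-- The nondeterministic counterpart of `PLIS`. -/
def NPLIS : Set BoolFamily := ndnuc ISbr poly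

/-! ### Classical complexity classes -/

/-- The pairing function on bit strings that converts `b₁…bₙ` and `c` into
`b₁b₁…bₙbₙ` followed by `1`, `0` and `c`. -/
def pairing (w c : List Bool) : List Bool :=
  w.flatMap (fun b => [b, b]) ++ true :: false :: c

/-- The class P: functions computed in polynomial time by a deterministic multi-stack Turing
machine with finite alphabets. -/
def PTime : Set (List Bool → Bool) :=
  {f | ∃ M : Turing.TM2ComputableInPolyTime (fun w : List Bool => w) Computability.encodeBool f,
    ∀ k, Finite (M.tm.Γ k)}

/-- The class NP, in terms of P and certificates of polynomial length. -/
def NPTime : Set (List Bool → Bool) :=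
  {f | ∃ p : Polynomial ℕ, ∃ g ∈ PTime, ∀ w : List Bool,
    f w = true ↔ ∃ c : List Bool, c.length = p.eval w.length ∧ g (pairing w c) = true}

/-- The class `C/F` of functions in `C` with advice that depends only on the length of the input and
whose length is bounded by a function from `F`. -/
def withAdvice (C : Set (List Bool → Bool)) (F : Set (ℕ → ℕ)) : Set (List Bool → Bool) :=
  {f | ∃ g ∈ C, ∃ h ∈ F, ∃ a : ℕ → List Bool, (∀ n, (a n).length ≤ h n) ∧
    ∀ w : List Bool, f w = g (pairing w (a w.length))}

/-- The class NP/poly. -/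
def NPpoly : Set (List Bool → Bool) := withAdvice NPTime poly

end InSeq

/-!
Boolean chains of bounded fan-in mediate between instruction sequences and Turing machines.

A polynomial-time machine makes local changes to its stacks only, so the contents of the stack cells
over time form a chain of polynomial length, and an instruction sequence evaluates a chain by
keeping its values in auxiliary registers. Conversely, jumps only lead forward, so the instructions
of an instruction sequence act at most once each and in their order; whether control reaches an
instruction, and the contents of the register it acts on, are determined by finitely many
earlier values, again by a chain. A chain of NAND gates becomes a program of head movements
and bit operations on a tape that contains the input followed by the certificate. Encoded as
advice, it is run by one fixed polynomial-time verifier.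
-/

namespace InSeq

/-! ### Polynomially bounded functions -/

theorem eval_mono (p : Polynomial ℕ) : Monotone fun n : ℕ => p.eval n := by
  intro m n h
  simp only [Polynomial.eval_eq_sum_range]
  gcongr

theorem le_eval_of_isBigO {h : ℕ → ℕ} {k : ℕ}
    (hk : (fun n => (h n : ℝ)) =O[Filter.atTop] fun n => (n : ℝ) ^ k) :
    ∃ p : Polynomial ℕ, ∀ n, h n ≤ p.eval n := by
  obtain ⟨C, hC⟩ := hk.bound
  obtain ⟨N, hN⟩ := Filter.eventually_atTop.1 hC
  refine ⟨Polynomial.C ⌈C⌉₊ * Polynomial.X ^ k + Polynomial.C (∑ i ∈ Finset.range N, h i),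
    fun n => ?_⟩
  simp only [Polynomial.eval_add, Polynomial.eval_mul, Polynomial.eval_C, Polynomial.eval_pow,
    Polynomial.eval_X]
  rcases lt_or_ge n N with hn | hn
  · exact (Finset.single_le_sum (f := h) (fun _ _ => Nat.zero_le _)
      (Finset.mem_range.2 hn)).trans (Nat.le_add_left _ _)
  · refine le_add_right ?_
    have bound : ‖(h n : ℝ)‖ ≤ C * ‖(n : ℝ) ^ k‖ := hN n hn
    simp only [Real.norm_natCast, norm_pow] at bound
    have : (h n : ℝ) ≤ ⌈C⌉₊ * (n : ℝ) ^ k := bound.trans (by gcongr; exact Nat.le_ceil C)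
    exact_mod_cast this

theorem eval_le_eval_one_mul_pow (p : Polynomial ℕ) {n : ℕ} (hn : 1 ≤ n) :
    p.eval n ≤ p.eval 1 * n ^ p.natDegree := by
  simp only [Polynomial.eval_eq_sum_range, Finset.sum_mul, one_pow, mul_one]
  gcongr with i hi
  exact Nat.lt_succ_iff.1 (Finset.mem_range.1 hi)

theorem mem_poly_iff {h : ℕ → ℕ} : h ∈ poly ↔ ∃ p : Polynomial ℕ, ∀ n, h n ≤ p.eval n := by
  refine ⟨fun ⟨_, hk⟩ => le_eval_of_isBigO hk, fun ⟨p, hp⟩ => ⟨p.natDegree, ?_⟩⟩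
  refine Asymptotics.IsBigO.of_bound (p.eval 1 : ℕ) ?_
  filter_upwards [Filter.eventually_ge_atTop 1] with n hn
  simp only [Real.norm_natCast, norm_pow]
  exact_mod_cast (hp n).trans (eval_le_eval_one_mul_pow p hn)

/-! ### Operational semantics of instruction sequences -/

/-- The contents of the registers after processing a basic instruction. -/
def upd (ρ : Focus → Service) (a : BasicInstr) : Focus → Service :=
  Function.update ρ a.focus ((ρ a.focus).derive a.method)

/-- Execution of a thread on a family of services: the final service named `out`. -/
def exec : Thread → (Focus → Service) → Service
  | .inaction, _ => .empty
  | .terminated, ρ => ρ .out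
  | .tau x, ρ => exec x ρ
  | .pcc x a y, ρ =>
    match (ρ a.focus).reply a.method with
    | some true => exec x (upd ρ a)
    | some false => exec y (upd ρ a)
    | none => .empty

theorem exec_use {f : Focus} (hf : f ≠ .out) (t : Thread) (S : Service) (ρ : Focus → Service) :
    exec (t.use f S) ρ = exec t (Function.update ρ f S) := by
  induction t generalizing S ρ with
  | inaction => rfl
  | terminated => simp [Thread.use, exec, Function.update_of_ne hf.symm]
  | tau x ih => simp [Thread.use, exec, ih]
  | pcc x a y ihx ihy =>
    by_cases h : a.focus = f
    · subst h
      rcases hr : S.reply a.method with _ | _ | _ <;>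
        simp [Thread.use, exec, hr, upd, ihx, ihy]
    · rcases hr : (ρ a.focus).reply a.method with _ | _ | _ <;>
        simp [Thread.use, exec, hr, upd, ihx, ihy, h, Function.update_comm h]

theorem apply_eq_exec (t : Thread) (S : Service) :
    t.apply .out S = exec t (Function.update (fun _ => .empty) .out S) := by
  induction t generalizing S with
  | inaction => rfl
  | terminated => simp [Thread.apply, exec]
  | tau x ih => simp [Thread.apply, exec, ih]
  | pcc x a y ihx ihy =>
    by_cases h : a.focus = .out
    · rcases hr : S.reply a.method with _ | _ | _ <;>
        simp [Thread.apply, exec, hr, upd, ihx, ihy, h]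
    · simp [Thread.apply, exec, h, Service.reply]

theorem exec_foldl_use {ι : Type*} {g : ι → Focus} {S : ι → Service} (hg : ∀ i, g i ≠ .out)
    {l : List ι} {ρ ρ' : Focus → Service} (mem : ∀ i ∈ l, ρ' (g i) = S i)
    (notMem : ∀ f, (∀ i ∈ l, g i ≠ f) → ρ' f = ρ f) (t : Thread) :
    exec (l.foldl (fun t i => t.use (g i) (S i)) t) ρ = exec t ρ' := by
  induction l using List.reverseRecOn generalizing ρ with
  | nil => rw [List.foldl_nil, funext fun f => notMem f (by simp)]
  | append_singleton l i ih =>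
    rw [List.foldl_append, List.foldl_cons, List.foldl_nil, exec_use (hg i)]
    refine ih (fun j hj => mem j (by simp [hj])) fun f hf => ?_
    by_cases hfi : f = g i
    · rw [hfi, Function.update_self, mem i (by simp)]
    · rw [Function.update_of_ne hfi]
      refine notMem f fun j hj => ?_
      rcases List.mem_append.1 hj with hj | hj
      · exact hf j hj
      · rw [List.mem_singleton.1 hj]; exact Ne.symm hfi

/-- The initial registers: inputs `b`, and `l` auxiliary registers and the output register
containing `false`. -/
def env {n : ℕ} (l : ℕ) (b : Fin n → Bool) : Focus → Service
  | .inp i => if h : i < n then .BR (b ⟨i, h⟩) else .empty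
  | .aux j => if j < l then .BR false else .empty
  | .out => .BR false

theorem exec_useInp {n : ℕ} (b : Fin n → Bool) (t : Thread) :
    exec (useInp b t) (Function.update (fun _ => .empty) .out (.BR false)) =
      exec t (env 0 b) := by
  refine exec_foldl_use (by simp) (by simp [env]) (fun f hf => ?_) t
  rcases f with i | j | _
  · have : ¬ i < n := fun h => hf ⟨i, h⟩ (List.mem_finRange _) rfl
    simp [env, this]
  · simp [env]
  · simp [env]

theorem exec_useAux {n : ℕ} (l : ℕ) (b : Fin n → Bool) (t : Thread) :
    exec (useAux l t) (env 0 b) = exec t (env l b) := by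
  refine exec_foldl_use (by simp) (by simp +contextual [env]) (fun f hf => ?_) t
  rcases f with i | j | _
  · rfl
  · have : ¬ j < l := fun h => hf j (List.mem_range.2 h) rfl
    simp [env, this]
  · rfl

theorem apply_useInp_useAux {n : ℕ} (l : ℕ) (b : Fin n → Bool) (t : Thread) :
    (useInp b (useAux l t)).apply .out (.BR false) = exec t (env l b) := by
  rw [apply_eq_exec, exec_useInp, exec_useAux]

/-- What execution does at an instruction: skip `k` more instructions before performing the next
one, or nothing because it has terminated or become inactive. -/
inductive Control
  | skip (k : ℕ)
  | terminated
  | inactive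
deriving DecidableEq

/-- An execution state, as seen between two consecutive instructions of a sequence. Passing the
instructions from left to right makes the semantics compositional in the sequence. -/
structure State where
  ctl : Control
  regs : Focus → Service

/-- Skipping `kt` or `kf` instructions on reply `true` or `false`, and inactivity when blocked. -/
def Control.ofReply (kt kf : ℕ) : Option Bool → Control
  | some true => .skip kt
  | some false => .skip kf
  | none => .inactive

/-- Performing the basic instruction `a`, with `kt` and `kf` as in `Control.ofReply`. -/
def performBasic (a : BasicInstr) (kt kf : ℕ) (ρ : Focus → Service) : State where
  ctl := .ofReply kt kf ((ρ a.focus).reply a.method)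
  regs := upd ρ a

/-- Performing a primitive instruction. -/
def Instr.step : Instr → (Focus → Service) → State
  | .basic a, ρ => performBasic a 0 0 ρ
  | .ptst a, ρ => performBasic a 0 1 ρ
  | .ntst a, ρ => performBasic a 1 0 ρ
  | .fjmp 0, ρ => ⟨.inactive, ρ⟩
  | .fjmp (l + 1), ρ => ⟨.skip l, ρ⟩
  | .halt, ρ => ⟨.terminated, ρ⟩

/-- The state past one more instruction, which is performed only if nothing is to be skipped. -/
def State.pass : State → Instr → State
  | ⟨.skip 0, ρ⟩, u => u.step ρ
  | ⟨.skip (k + 1), ρ⟩, _ => ⟨.skip k, ρ⟩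
  | ⟨.terminated, ρ⟩, _ => ⟨.terminated, ρ⟩
  | ⟨.inactive, ρ⟩, _ => ⟨.inactive, ρ⟩

/-- Passing all instructions of a sequence. -/
def run (X : List Instr) (s : State) : State := X.foldl State.pass s

/-- The final service named `out`; past the end of a sequence, only a terminated execution has
one. -/
def State.outcome : State → Service
  | ⟨.terminated, ρ⟩ => ρ .out
  | _ => .empty

@[simp] theorem run_nil (s : State) : run [] s = s := rfl

@[simp] theorem run_cons (u : Instr) (X : List Instr) (s : State) :
    run (u :: X) s = run X (s.pass u) := rfl

@[simp] theorem State.pass_skip_zero (ρ : Focus → Service) (u : Instr) :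
    State.pass ⟨.skip 0, ρ⟩ u = u.step ρ := rfl

@[simp] theorem State.pass_skip_succ (k : ℕ) (ρ : Focus → Service) (u : Instr) :
    State.pass ⟨.skip (k + 1), ρ⟩ u = ⟨.skip k, ρ⟩ := rfl

theorem run_append (X Y : List Instr) (s : State) : run (X ++ Y) s = run Y (run X s) :=
  List.foldl_append

theorem run_of_terminated (X : List Instr) (ρ : Focus → Service) :
    run X ⟨.terminated, ρ⟩ = ⟨.terminated, ρ⟩ := by
  induction X with
  | nil => rfl
  | cons _ _ ih => exact ih

theorem run_of_inactive (X : List Instr) (ρ : Focus → Service) :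
    run X ⟨.inactive, ρ⟩ = ⟨.inactive, ρ⟩ := by
  induction X with
  | nil => rfl
  | cons _ _ ih => exact ih

theorem run_of_skip_length_add (X : List Instr) (k : ℕ) (ρ : Focus → Service) :
    run X ⟨.skip (X.length + k), ρ⟩ = ⟨.skip k, ρ⟩ := by
  induction X with
  | nil => simp
  | cons u X ih => rw [List.length_cons, Nat.add_right_comm]; exact ih

theorem exec_extr (X : List Instr) (ρ : Focus → Service) :
    exec (extr X) ρ = (run X ⟨.skip 0, ρ⟩).outcome ∧
      ∀ k, exec (extr (.fjmp (k + 1) :: X)) ρ = (run X ⟨.skip k, ρ⟩).outcome := by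
  induction X generalizing ρ with
  | nil =>
    refine ⟨by simp [extr, exec, State.outcome], fun k => ?_⟩
    cases k <;> simp [extr, exec, State.outcome]
  | cons u X ih =>
    have perform : exec (extr (u :: X)) ρ = (run (u :: X) ⟨.skip 0, ρ⟩).outcome := by
      rcases u with a | a | a | (_ | l) | _
      case basic | ptst | ntst =>
        rcases hr : (ρ a.focus).reply a.method with _ | _ | _ <;>
          simp [extr, exec, State.pass, Instr.step, performBasic, Control.ofReply, hr, ih,
            run_of_inactive, State.outcome]
      case fjmp.zero => simp [extr, exec, State.pass, Instr.step, run_of_inactive, State.outcome]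
      case fjmp.succ => exact (ih ρ).2 l
      case halt => simp [extr, exec, State.pass, Instr.step, run_of_terminated, State.outcome]
    refine ⟨perform, fun k => ?_⟩
    cases k with
    | zero => rw [extr, perform]
    | succ k => rw [extr, (ih ρ).2]; rfl

theorem computes_iff {n : ℕ} {X : List Instr} {f : (Fin n → Bool) → Bool} :
    Computes X f ↔ ∃ l, ∀ b, (run X ⟨.skip 0, env l b⟩).outcome = .BR (f b) := by
  simp only [Computes, apply_useInp_useAux, (exec_extr X _).1]

/-! ### Chains of Boolean functions -/

/-- The `m`-ary Boolean functions. -/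
abbrev BoolFun (m : ℕ) := (Fin m → Bool) → Bool

section Chain

variable {m d : ℕ} {L L' : List (BoolFun m)} {f s : BoolFun m}

/-- The functions that are available once those in `L` have been computed: the members of `L` and
the coordinate functions. -/
def Avail (L : List (BoolFun m)) (s : BoolFun m) : Prop :=
  s ∈ L ∨ ∃ i, s = fun b => b i

theorem Avail.mono (hs : Avail L s) (h : L ⊆ L') : Avail L' s :=
  hs.imp_left (h ·)

/-- Lists of Boolean functions, in the order of their computation, in which each function is
obtained from those before it by a gate as specified by `G`. Chains of gates of bounded fan-in
mediate between instruction sequences and Turing machines. -/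
inductive Chain (G : List (BoolFun m) → BoolFun m → Prop) : List (BoolFun m) → Prop
  | nil : Chain G []
  | snoc {L : List (BoolFun m)} {f : BoolFun m} (hL : Chain G L) (hf : G L f) : Chain G (L ++ [f])

/-- Gates of fan-in at most `d`: the value of `f` is determined by the values of at most `d`
available functions. -/
def LocalGate (d : ℕ) (L : List (BoolFun m)) (f : BoolFun m) : Prop :=
  ∃ S : List (BoolFun m), (∀ s ∈ S, Avail L s) ∧ S.length ≤ d ∧
    f.FactorsThrough fun b => S.map fun s => s b

theorem LocalGate.mono (hf : LocalGate d L f) (h : L ⊆ L') : LocalGate d L' f :=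
  let ⟨S, hS, hd, hfS⟩ := hf
  ⟨S, fun s hs => (hS s hs).mono h, hd, hfS⟩

theorem Chain.append (hL : Chain (LocalGate d) L) (hL' : ∀ f ∈ L', LocalGate d L f) :
    Chain (LocalGate d) (L ++ L') := by
  induction L' using List.reverseRecOn with
  | nil => simpa using hL
  | append_singleton L' f ih =>
    rw [← List.append_assoc]
    exact (ih fun g hg => hL' g (by simp [hg])).snoc ((hL' f (by simp)).mono (by simp))

end Chain

/-! ### From chains to instruction sequences -/

/-- The instruction sequence that sets the register `z` to the value of `φ` at the contents of the
registers in a list, by a binary decision tree. -/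
def decisionTree (z : Focus) : List Focus → (List Bool → Bool) → List Instr
  | [], φ => [.basic ⟨z, .set (φ [])⟩]
  | s :: S, φ =>
    .ntst ⟨s, .get⟩ :: .fjmp ((decisionTree z S (φ ∘ List.cons true)).length + 2) ::
      (decisionTree z S (φ ∘ List.cons true) ++
        .fjmp ((decisionTree z S (φ ∘ List.cons false)).length + 1) ::
          decisionTree z S (φ ∘ List.cons false))

theorem length_decisionTree (z : Focus) (S : List Focus) (φ : List Bool → Bool) :
    (decisionTree z S φ).length + 3 = 4 * 2 ^ S.length := by
  induction S generalizing φ with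
  | nil => simp [decisionTree]
  | cons s S ih =>
    have length_true := ih (φ ∘ List.cons true)
    have length_false := ih (φ ∘ List.cons false)
    simp only [decisionTree, List.length_cons, List.length_append, pow_succ]
    omega

theorem permitted_get {r : Focus} (hr : r ≠ .out) : BasicInstr.Permitted ⟨r, .get⟩ := by
  cases r <;> trivial

theorem permitted_decisionTree (z : ℕ) {S : List Focus} (hS : ∀ s ∈ S, s ≠ .out)
    (φ : List Bool → Bool) : ∀ u ∈ decisionTree (.aux z) S φ, u.Permitted := by
  induction S generalizing φ with
  | nil => simp [decisionTree, Instr.Permitted, BasicInstr.Permitted]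
  | cons s S ih =>
    rw [List.forall_mem_cons] at hS
    simp only [decisionTree, List.forall_mem_cons, List.forall_mem_append]
    exact ⟨permitted_get hS.1, trivial, ih hS.2 _, trivial, ih hS.2 _⟩

theorem performBasic_get {ρ : Focus → Service} {r : Focus} {x : Bool} (hr : ρ r = .BR x)
    (kt kf : ℕ) : performBasic ⟨r, .get⟩ kt kf ρ = ⟨.skip (if x then kt else kf), ρ⟩ := by
  have : upd ρ ⟨r, .get⟩ = ρ := by
    simp [upd, hr, Service.derive, Function.update_eq_self_iff]
  cases x <;> simp [performBasic, Control.ofReply, hr, Service.reply, this]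

theorem performBasic_set {ρ : Focus → Service} {r : Focus} (hr : ρ r ≠ .empty) (x : Bool)
    (kt kf : ℕ) : performBasic ⟨r, .set x⟩ kt kf ρ =
      ⟨.skip (if x then kt else kf), Function.update ρ r (.BR x)⟩ := by
  rcases h : ρ r with _ | y
  · exact absurd h hr
  · cases x <;> simp [performBasic, Control.ofReply, upd, h, Service.reply, Service.derive]

theorem run_decisionTree {z : Focus} {S : List Focus} {v : List Bool} {ρ : Focus → Service}
    (hS : S.map ρ = v.map .BR) (hz : ρ z ≠ .empty) (φ : List Bool → Bool) :
    run (decisionTree z S φ) ⟨.skip 0, ρ⟩ = ⟨.skip 0, Function.update ρ z (.BR (φ v))⟩ := by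
  induction S generalizing φ v with
  | nil =>
    obtain rfl : v = [] := by simpa using hS.symm
    simp [decisionTree, Instr.step, performBasic_set hz]
  | cons s S ih =>
    rcases v with _ | ⟨x, v⟩
    · simp at hS
    obtain ⟨hs, hS'⟩ : ρ s = .BR x ∧ S.map ρ = v.map .BR := by simpa using hS
    simp only [decisionTree, run_cons, State.pass_skip_zero, Instr.step, performBasic_get hs,
      run_append]
    cases x
    · rw [if_neg Bool.false_ne_true, State.pass_skip_zero, Instr.step, run_of_skip_length_add]
      exact ih hS' _
    · rw [if_pos rfl, State.pass_skip_succ, ih hS']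
      exact run_of_skip_length_add _ 0 _

section Holds

variable {m d : ℕ} {L : List (BoolFun m)} {f s : BoolFun m} {l : ℕ} {b : Fin m → Bool}
  {ρ : Focus → Service}

/-- The invariant of the evaluation of a chain: the input registers contain `b`, the first
auxiliary registers contain the values at `b` of the functions in `L`, and the first `l` auxiliary
registers can be used. -/
structure Holds (L : List (BoolFun m)) (l : ℕ) (b : Fin m → Bool) (ρ : Focus → Service) : Prop where
  inp : ∀ i : Fin m, ρ (.inp i) = .BR (b i)
  out : ρ .out = .BR false
  aux_ne : ∀ j < l, ρ (.aux j) ≠ .empty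
  aux : ∀ (j : ℕ) (hj : j < L.length), ρ (.aux j) = .BR (L[j] b)

theorem holds_env (l : ℕ) (b : Fin m → Bool) : Holds [] l b (env l b) where
  inp i := by simp [env]
  out := rfl
  aux_ne j hj := by simp [env, hj]
  aux := by simp

theorem Holds.snoc (h : Holds L l b ρ) (f : BoolFun m) :
    Holds (L ++ [f]) l b (Function.update ρ (.aux L.length) (.BR (f b))) where
  inp i := by simp [h.inp]
  out := by simp [h.out]
  aux_ne j hj := by
    by_cases e : j = L.length
    · simp [e]
    · simpa [e] using h.aux_ne j hj
  aux j hj := by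
    rw [List.length_append, List.length_singleton] at hj
    rcases (Nat.lt_succ_iff.1 hj).eq_or_lt with rfl | hj
    · simp
    · rw [Function.update_of_ne (by simpa using hj.ne), List.getElem_append_left hj, h.aux]

theorem Avail.exists_focus (hs : Avail L s) :
    ∃ r : Focus, r ≠ .out ∧ ∀ {l b ρ}, Holds L l b ρ → ρ r = .BR (s b) := by
  rcases hs with hs | ⟨i, rfl⟩
  · obtain ⟨j, hj, rfl⟩ := List.getElem_of_mem hs
    exact ⟨.aux j, by simp, fun h => h.aux j hj⟩
  · exact ⟨.inp i, by simp, fun h => h.inp i⟩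

theorem LocalGate.exists_instrs (hf : LocalGate d L f) :
    ∃ X : List Instr, (∀ u ∈ X, u.Permitted) ∧ X.length ≤ 4 * 2 ^ d ∧
      ∀ {l b ρ}, L.length < l → Holds L l b ρ →
        ∃ ρ', Holds (L ++ [f]) l b ρ' ∧ run X ⟨.skip 0, ρ⟩ = ⟨.skip 0, ρ'⟩ := by
  obtain ⟨S, hS, hd, hfS⟩ := hf
  obtain ⟨φ, rfl⟩ := (Function.factorsThrough_iff _).1 hfS
  have : Nonempty Focus := ⟨.out⟩
  choose! r r_ne hr using fun s hs => (hS s hs).exists_focus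
  refine ⟨decisionTree (.aux L.length) (S.map r) φ,
    permitted_decisionTree _ (by simpa using r_ne) _, ?_, fun {l b ρ} hl h => ?_⟩
  · have := length_decisionTree (.aux L.length) (S.map r) φ
    rw [List.length_map] at this
    have : 2 ^ S.length ≤ 2 ^ d := Nat.pow_le_pow_right two_pos hd
    omega
  · refine ⟨_, h.snoc _, run_decisionTree ?_ (h.aux_ne _ hl) φ⟩
    simpa using fun s hs => hr s hs h

theorem Chain.exists_instrs (hL : Chain (LocalGate d) L) :
    ∃ X : List Instr, (∀ u ∈ X, u.Permitted) ∧ X.length ≤ L.length * (4 * 2 ^ d) ∧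
      ∀ {l}, L.length ≤ l → ∀ b, ∃ ρ, Holds L l b ρ ∧ run X ⟨.skip 0, env l b⟩ = ⟨.skip 0, ρ⟩ := by
  induction hL with
  | nil => exact ⟨[], by simp, by simp, fun {l} _ b => ⟨_, holds_env l b, rfl⟩⟩
  | snoc _ hf ih =>
    obtain ⟨X, hX, X_le, run_X⟩ := ih
    obtain ⟨Y, hY, Y_le, run_Y⟩ := hf.exists_instrs
    refine ⟨X ++ Y, List.forall_mem_append.2 ⟨hX, hY⟩, ?_, fun {l} hl b => ?_⟩
    · rw [List.length_append, List.length_append, List.length_singleton, Nat.succ_mul]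
      exact add_le_add X_le Y_le
    · rw [List.length_append, List.length_singleton] at hl
      obtain ⟨ρ, hρ, run_ρ⟩ := run_X (Nat.le_of_succ_le hl) b
      obtain ⟨ρ', hρ', run_ρ'⟩ := run_Y hl hρ
      exact ⟨ρ', hρ', by rw [run_append, run_ρ, run_ρ']⟩

theorem Chain.exists_computes (hL : Chain (LocalGate d) L) (hf : f ∈ L) :
    ∃ X ∈ ISbr, Computes X f ∧ X.length ≤ L.length * (4 * 2 ^ d) + 3 := by
  obtain ⟨X, hX, X_le, run_X⟩ := hL.exists_instrs
  obtain ⟨r, hr, reg⟩ := Avail.exists_focus (.inl hf)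
  let output : List Instr := [.ptst ⟨r, .get⟩, .basic ⟨.out, .set true⟩, .halt]
  refine ⟨X ++ output, ⟨by simp [output], List.forall_mem_append.2 ⟨hX, ?_⟩⟩,
    computes_iff.2 ⟨L.length, fun b => ?_⟩, by simpa [output] using X_le⟩
  · simpa [output, Instr.Permitted, BasicInstr.Permitted] using permitted_get hr
  · obtain ⟨ρ, hρ, run_ρ⟩ := run_X le_rfl b
    rw [run_append, run_ρ]
    cases hb : f b <;>
      simp [output, Instr.step, performBasic_get (reg hρ), performBasic_set, hb, hρ.out,
        State.outcome]

end Holds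

/-! ### From instruction sequences to chains -/

theorem Instr.exists_step_eq (u : Instr) :
    ∃ (r : Focus) (next : Service → Control) (effect : Service → Service) (k₀ : ℕ),
      (∀ ρ, u.step ρ = ⟨next (ρ r), Function.update ρ r (effect (ρ r))⟩) ∧
      (∀ S, effect S = .empty ↔ S = .empty) ∧
      ∀ S k, next S = .skip k → k = k₀ ∨ k = k₀ + 1 := by
  have derive_eq_empty (M : Method) (S : Service) : S.derive M = .empty ↔ S = .empty := by
    cases M <;> cases S <;> simp [Service.derive]
  rcases u with a | a | a | (_ | l) | _
  case basic | ptst | ntst =>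
    refine ⟨a.focus, fun S => .ofReply _ _ (S.reply a.method), Service.derive a.method, 0,
      fun ρ => rfl, derive_eq_empty _, fun S k h => ?_⟩
    rcases hr : S.reply a.method with _ | _ | _ <;> simp_all [Control.ofReply, eq_comm]
  case fjmp.zero => exact ⟨.out, fun _ => .inactive, id, 0, by simp [step]⟩
  case fjmp.succ => exact ⟨.out, fun _ => .skip l, id, l, by simp +contextual [step]⟩
  case halt => exact ⟨.out, fun _ => .terminated, id, 0, by simp [step]⟩

theorem State.pass_ctl_eq_skip_iff {s : State} {u : Instr} {k : ℕ} :
    (s.pass u).ctl = .skip k ↔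
      s.ctl = .skip (k + 1) ∨ s.ctl = .skip 0 ∧ (u.step s.regs).ctl = .skip k := by
  obtain ⟨(_ | k) | _ | _, ρ⟩ := s <;> simp [State.pass]

theorem State.pass_regs (s : State) (u : Instr) (r : Focus) :
    (s.pass u).regs r = if s.ctl = .skip 0 then (u.step s.regs).regs r else s.regs r := by
  obtain ⟨(_ | k) | _ | _, ρ⟩ := s <;> simp [State.pass]

theorem State.regs_out_of_outcome_eq {s : State} {x : Bool} (h : s.outcome = .BR x) :
    s.regs .out = .BR x := by
  obtain ⟨_ | _ | _, ρ⟩ := s <;> first | exact h | cases h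

section Tracks

variable {m : ℕ} {L : List (BoolFun m)} {s : (Fin m → Bool) → State}

/-- The execution state, as a function of the input, is expressed by available functions. Which
registers exist must not depend on the input. -/
structure Tracks (L : List (BoolFun m)) (s : (Fin m → Bool) → State) : Prop where
  ctl : ∀ k, Avail L fun b => decide ((s b).ctl = .skip k)
  regs : ∀ r, Avail L fun b => decide ((s b).regs r = .BR true)
  empty_congr : ∀ r b b', (s b).regs r = .empty → (s b').regs r = .empty

theorem Tracks.regs_congr (h : Tracks L s) {r : Focus} {b b' : Fin m → Bool}
    (hr : decide ((s b).regs r = .BR true) = decide ((s b').regs r = .BR true)) :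
    (s b).regs r = (s b').regs r := by
  have empty := h.empty_congr r b b'
  have empty' := h.empty_congr r b' b
  rcases hb : (s b).regs r with _ | _ | _ <;> rcases hb' : (s b').regs r with _ | _ | _ <;>
    simp_all

theorem Tracks.localGate_of_congr (h : Tracks L s) (k : ℕ) (r : Focus) {f : BoolFun m}
    (hf : ∀ b b', ((s b).ctl = .skip (k + 1) ↔ (s b').ctl = .skip (k + 1)) →
      ((s b).ctl = .skip 0 ↔ (s b').ctl = .skip 0) → (s b).regs r = (s b').regs r → f b = f b') :
    LocalGate 3 L f := by
  refine ⟨[fun b => decide ((s b).ctl = .skip (k + 1)), fun b => decide ((s b).ctl = .skip 0),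
    fun b => decide ((s b).regs r = .BR true)], ?_, le_rfl, fun b b' hbb' => ?_⟩
  · simpa using ⟨h.ctl (k + 1), h.ctl 0, h.regs r⟩
  · simp only [List.map_cons, List.map_nil, List.cons.injEq, and_true] at hbb'
    exact hf b b' (decide_eq_decide.1 hbb'.1) (decide_eq_decide.1 hbb'.2.1)
      (h.regs_congr hbb'.2.2)

theorem Tracks.exists_pass (h : Tracks L s) (u : Instr) :
    ∃ L' : List (BoolFun m), L'.length = 3 ∧ (∀ f ∈ L', LocalGate 3 L f) ∧
      Tracks (L ++ L') fun b => (s b).pass u := by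
  obtain ⟨r, next, effect, k₀, step_eq, effect_empty, next_eq⟩ := u.exists_step_eq
  let ctl (k : ℕ) : BoolFun m := fun b => decide (((s b).pass u).ctl = .skip k)
  let reg : BoolFun m := fun b => decide (((s b).pass u).regs r = .BR true)
  have ctl_gate (k : ℕ) : LocalGate 3 L (ctl k) := by
    refine h.localGate_of_congr k r fun b b' hk h0 hr => ?_
    simp only [ctl, State.pass_ctl_eq_skip_iff, step_eq, hk, h0, hr]
  have reg_gate : LocalGate 3 L reg := by
    refine h.localGate_of_congr 0 r fun b b' _ h0 hr => ?_
    simp only [reg, State.pass_regs, step_eq, h0]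
    split_ifs <;> simp [hr]
  refine ⟨[ctl k₀, ctl (k₀ + 1), reg], rfl, by simp [ctl_gate, reg_gate], ?_, ?_, ?_⟩
  · intro k
    by_cases hk : k = k₀ ∨ k = k₀ + 1
    · exact .inl (by rcases hk with rfl | rfl <;> simp [ctl])
    · have : ∀ S, next S ≠ .skip k := fun S hS => hk (next_eq S k hS)
      simpa [State.pass_ctl_eq_skip_iff, step_eq, this] using
        (h.ctl (k + 1)).mono (List.subset_append_left _ _)
  · intro r'
    by_cases hr : r' = r
    · exact .inl (by simp [hr, reg])
    · simpa [State.pass_regs, step_eq, hr] using (h.regs r').mono (List.subset_append_left _ _)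
  · intro r' b b'
    have regs_empty (b : Fin m → Bool) :
        ((s b).pass u).regs r' = .empty ↔ (s b).regs r' = .empty := by
      by_cases hr : r' = r <;> by_cases h0 : (s b).ctl = .skip 0 <;>
        simp [State.pass_regs, step_eq, hr, h0, effect_empty]
    rw [regs_empty, regs_empty]
    exact h.empty_congr r' b b'

theorem Tracks.exists_run (hL : Chain (LocalGate 3) L) (h : Tracks L s) (X : List Instr) :
    ∃ L' : List (BoolFun m), L'.length = L.length + 3 * X.length ∧ Chain (LocalGate 3) L' ∧
      Tracks L' fun b => run X (s b) := by
  induction X generalizing L s with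
  | nil => exact ⟨L, rfl, hL, h⟩
  | cons u X ih =>
    obtain ⟨F, F_length, F_gate, hF⟩ := h.exists_pass u
    obtain ⟨L', L'_length, hL', h'⟩ := ih (hL.append F_gate) hF
    refine ⟨L', ?_, hL', h'⟩
    rw [L'_length, List.length_append, F_length, List.length_cons]
    ring

theorem localGate_const (d : ℕ) (L : List (BoolFun m)) (x : Bool) :
    LocalGate d L fun _ => x :=
  ⟨[], by simp, by simp, fun _ _ _ => rfl⟩

theorem tracks_env (l : ℕ) :
    Tracks [fun _ => false, fun _ => true] fun b : Fin m → Bool => ⟨.skip 0, env l b⟩ where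
  ctl k := .inl (by cases k <;> simp)
  regs r := by
    rcases r with i | j | _
    · by_cases hi : i < m
      · exact .inr ⟨⟨i, hi⟩, by simp [env, hi]⟩
      · exact .inl (by simp [env, hi])
    · exact .inl (by by_cases hj : j < l <;> simp [env, hj])
    · exact .inl (by simp [env])
  empty_congr r b b' := by
    rcases r with i | j | _
    · by_cases hi : i < m <;> simp [env, hi]
    · exact id
    · exact id

theorem Computes.exists_chain {X : List Instr} {f : BoolFun m} (hX : Computes X f) :
    ∃ L : List (BoolFun m), Chain (LocalGate 3) L ∧ L.length = 3 * X.length + 2 ∧ Avail L f := by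
  obtain ⟨l, hl⟩ := computes_iff.1 hX
  have consts : Chain (LocalGate 3) [fun _ : Fin m → Bool => false, fun _ => true] :=
    (Chain.nil.snoc (localGate_const 3 _ false)).snoc (localGate_const 3 _ true)
  obtain ⟨L, L_length, hL, h⟩ := (tracks_env l).exists_run consts X
  refine ⟨L, hL, by simp [L_length, add_comm], ?_⟩
  simpa [State.regs_out_of_outcome_eq (hl _)] using h.regs .out

end Tracks

open Turing

/-! ### Locality of multi-stack machines -/

section Locality

variable {K : Type*} {Γ : K → Type*} {Λ σ : Type*} {D D' : ℕ} {P Q : Finset ℕ}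
  {S S' : ∀ k, List (Γ k)} {c c' : TM2.Cfg Γ Λ σ}

/-- Two families of stacks agree on the positions in `P`, which are counted from the top. -/
def AgreeOn (P : Finset ℕ) (S S' : ∀ k, List (Γ k)) : Prop :=
  ∀ k, ∀ i ∈ P, (S k)[i]? = (S' k)[i]?

/-- Two configurations agree on the label, the internal state and the positions in `P`. -/
structure AgreeCfg (P : Finset ℕ) (c c' : TM2.Cfg Γ Λ σ) : Prop where
  l_eq : c.l = c'.l
  var_eq : c.var = c'.var
  agreeOn : AgreeOn P c.stk c'.stk

/-- The positions that determine the contents of the positions in `P` after a computation that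
pushes, peeks and pops at most `D` times. -/
def window (D : ℕ) (P : Finset ℕ) : Finset ℕ :=
  Finset.range D ∪ P.biUnion fun i => Finset.Icc (i - D) (i + D)

theorem mem_window {j : ℕ} : j ∈ window D P ↔ j < D ∨ ∃ i ∈ P, i ≤ j + D ∧ j ≤ i + D := by
  simp [window]

theorem window_mono (h : D ≤ D') : window D P ⊆ window D' P := fun j hj => by
  rw [mem_window] at hj ⊢
  exact hj.imp (by omega) fun ⟨i, hi, h₁, h₂⟩ => ⟨i, hi, by omega, by omega⟩

theorem subset_window (D : ℕ) (P : Finset ℕ) : P ⊆ window D P :=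
  fun i hi => mem_window.2 (.inr ⟨i, hi, by omega, by omega⟩)

theorem mem_window_of_succ_mem {j : ℕ} (h : j + 1 ∈ window D P) : j ∈ window (D + 1) P := by
  rw [mem_window] at h ⊢
  exact h.imp (by omega) fun ⟨i, hi, h₁, h₂⟩ => ⟨i, hi, by omega, by omega⟩

theorem succ_mem_window {j : ℕ} (h : j ∈ window D P) : j + 1 ∈ window (D + 1) P := by
  rw [mem_window] at h ⊢
  exact h.imp (by omega) fun ⟨i, hi, h₁, h₂⟩ => ⟨i, hi, by omega, by omega⟩

theorem card_window_le (hP : P.card ≤ 1) : (window D P).card ≤ 3 * D + 1 := by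
  have union : (P.biUnion fun i => Finset.Icc (i - D) (i + D)).card ≤ P.card * (2 * D + 1) :=
    Finset.card_biUnion_le_card_mul _ _ _ fun i _ => by rw [Nat.card_Icc]; omega
  have := Finset.card_union_le (Finset.range D) (P.biUnion fun i => Finset.Icc (i - D) (i + D))
  rw [Finset.card_range] at this
  rw [window]
  nlinarith

theorem window_subset_range {R : ℕ} (hP : P ⊆ Finset.range R) :
    window D P ⊆ Finset.range (R + D) := fun j hj => by
  rw [Finset.mem_range]
  rcases mem_window.1 hj with hj | ⟨i, hi, -, hj⟩
  · omega
  · have := Finset.mem_range.1 (hP hi)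
    omega

theorem AgreeOn.mono (h : AgreeOn Q S S') (hPQ : P ⊆ Q) : AgreeOn P S S' :=
  fun k i hi => h k i (hPQ hi)

theorem AgreeOn.head?_eq (h : AgreeOn P S S') (h0 : 0 ∈ P) (k : K) :
    (S k).head? = (S' k).head? := by
  simpa only [List.head?_eq_getElem?] using h k 0 h0

variable [DecidableEq K]

theorem AgreeOn.push (h : AgreeOn (window (D + 1) P) S S') (k : K) (x : Γ k) :
    AgreeOn (window D P) (Function.update S k (x :: S k)) (Function.update S' k (x :: S' k)) := by
  intro k' i hi
  by_cases hk : k' = k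
  · subst hk
    cases i with
    | zero => simp
    | succ i => simpa using h k' i (mem_window_of_succ_mem hi)
  · simpa only [Function.update_of_ne hk] using h k' i (window_mono D.le_succ hi)

theorem AgreeOn.pop (h : AgreeOn (window (D + 1) P) S S') (k : K) :
    AgreeOn (window D P) (Function.update S k (S k).tail) (Function.update S' k (S' k).tail) := by
  intro k' i hi
  by_cases hk : k' = k
  · subst hk
    simpa using h k' (i + 1) (succ_mem_window hi)
  · simpa only [Function.update_of_ne hk] using h k' i (window_mono D.le_succ hi)

/-- A bound on the number of accesses to the stacks in the execution of a statement. -/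
def stmtDepth : TM2.Stmt Γ Λ σ → ℕ
  | .push _ _ q => stmtDepth q + 1
  | .peek _ _ q => stmtDepth q + 1
  | .pop _ _ q => stmtDepth q + 1
  | .load _ q => stmtDepth q
  | .branch _ q₁ q₂ => max (stmtDepth q₁) (stmtDepth q₂)
  | .goto _ => 0
  | .halt => 0

theorem AgreeOn.stepAux {q : TM2.Stmt Γ Λ σ} (hq : stmtDepth q ≤ D) (v : σ)
    (h : AgreeOn (window D P) S S') : AgreeCfg P (TM2.stepAux q v S) (TM2.stepAux q v S') := by
  induction q generalizing D v S S' with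
  | push k f q ih =>
    exact ih (Nat.le_refl _) _ ((h.mono (window_mono hq)).push k (f v))
  | peek k f q ih =>
    have h := h.mono (window_mono hq)
    simpa only [TM2.stepAux, h.head?_eq (mem_window.2 (.inl (Nat.succ_pos _))) k] using
      ih (Nat.le_succ _) (f v (S' k).head?) h
  | pop k f q ih =>
    have h := h.mono (window_mono hq)
    simpa only [TM2.stepAux, h.head?_eq (mem_window.2 (.inl (Nat.succ_pos _))) k] using
      ih (Nat.le_refl _) (f v (S' k).head?) (h.pop k)
  | load a q ih => exact ih hq (a v) h
  | branch p q₁ q₂ ih₁ ih₂ =>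
    obtain ⟨hq₁, hq₂⟩ := max_le_iff.1 hq
    cases hp : p v
    · simpa only [TM2.stepAux, hp, cond_false] using ih₂ hq₂ v h
    · simpa only [TM2.stepAux, hp, cond_true] using ih₁ hq₁ v h
  | goto => exact ⟨rfl, rfl, h.mono (subset_window D P)⟩
  | halt => exact ⟨rfl, rfl, h.mono (subset_window D P)⟩

/-- A partial transition function made total: final states stay as they are. -/
def totalize {α : Type*} (f : α → Option α) (a : α) : α :=
  (f a).getD a

theorem iterate_totalize {α : Type*} {f : α → Option α} {a b : α} {n : ℕ}
    (h : (flip bind f)^[n] (some a) = some b) : (totalize f)^[n] a = b := by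
  induction n generalizing a with
  | zero => simpa using h
  | succ n ih =>
    rw [Function.iterate_succ_apply, show flip bind f (some a) = f a from rfl] at h
    rw [Function.iterate_succ_apply, totalize]
    cases ha : f a with
    | none =>
      rw [ha, Function.iterate_fixed rfl] at h
      cases h
    | some a' => exact ih (ha ▸ h)

theorem iterate_totalize_of_evalsToInTime {α : Type*} {f : α → Option α} {a b : α} {t : ℕ}
    (h : StateTransition.EvalsToInTime f a (some b) t) (hb : f b = none) :
    (totalize f)^[t] a = b := by
  have b_fixed : totalize f b = b := by rw [totalize, hb, Option.getD_none]
  rw [← Nat.sub_add_cancel h.steps_le_m, Function.iterate_add_apply,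
    iterate_totalize h.evals_in_steps, Function.iterate_fixed b_fixed]

/-- The maximal depth of the statements of a machine. -/
def machineDepth [Fintype Λ] (M : Λ → TM2.Stmt Γ Λ σ) : ℕ :=
  Finset.univ.sup fun l => stmtDepth (M l)

theorem AgreeCfg.totalize_step [Fintype Λ] (M : Λ → TM2.Stmt Γ Λ σ)
    (h : AgreeCfg (window (machineDepth M) P) c c') :
    AgreeCfg P (totalize (TM2.step M) c) (totalize (TM2.step M) c') := by
  obtain ⟨_ | l, v, S⟩ := c <;> obtain ⟨l', v', S'⟩ := c' <;>
    obtain ⟨rfl, rfl, h⟩ : _ = l' ∧ v = v' ∧ _ := ⟨h.l_eq, h.var_eq, h.agreeOn⟩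
  · exact ⟨rfl, rfl, h.mono (subset_window _ P)⟩
  · exact h.stepAux (Finset.le_sup (f := fun l => stmtDepth (M l)) (Finset.mem_univ l)) v

end Locality

/-! ### Computations of multi-stack machines as chains -/

section Tableau

variable {K : Type*} {Γ : K → Type*} {Λ σ : Type*}

/-- Names of the bits that describe a configuration: `inl` stands for the label and the internal
state, `inr (i, x)` for the contents `x.2` of position `i`, counted from the top, of stack `x.1`. -/
abbrev CfgBit (Γ : K → Type*) (Λ σ : Type*) := (Option Λ × σ) ⊕ (ℕ × Σ k, Γ k)

open Classical in
/-- The value of a bit in a configuration. -/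
noncomputable def CfgBit.val (c : TM2.Cfg Γ Λ σ) : CfgBit Γ Λ σ → Bool
  | .inl y => decide ((c.l, c.var) = y)
  | .inr (i, x) => decide ((c.stk x.1)[i]? = some x.2)

variable [Fintype K] [∀ k, Fintype (Γ k)] [Fintype Λ] [Fintype σ] {P Q : Finset ℕ}

variable (Γ Λ σ) in
/-- The bits of the control and of the positions in `P`. -/
def bits (P : Finset ℕ) : Finset (CfgBit Γ Λ σ) :=
  Finset.univ.disjSum (P ×ˢ Finset.univ)

theorem inl_mem_bits (y : Option Λ × σ) : .inl y ∈ bits Γ Λ σ P := by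
  simp [bits]

theorem inr_mem_bits {i : ℕ} {x : Σ k, Γ k} : .inr (i, x) ∈ bits Γ Λ σ P ↔ i ∈ P := by
  simp [bits]

theorem bits_mono (h : P ⊆ Q) : bits Γ Λ σ P ⊆ bits Γ Λ σ Q :=
  Finset.disjSum_mono_right _ (Finset.product_subset_product_left h)

variable (Γ Λ σ) in
theorem exists_card_bits_le : ∃ A, ∀ P, (bits Γ Λ σ P).card ≤ A * (P.card + 1) := by
  refine ⟨Fintype.card (Option Λ × σ) + Fintype.card (Σ k, Γ k), fun P => ?_⟩
  rw [bits, Finset.card_disjSum, Finset.card_product, Finset.card_univ, Finset.card_univ]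
  nlinarith

theorem exists_mem_bits_of_card_le_one {β : CfgBit Γ Λ σ} (hβ : β ∈ bits Γ Λ σ P) :
    ∃ P' ⊆ P, P'.card ≤ 1 ∧ β ∈ bits Γ Λ σ P' := by
  rcases β with y | ⟨i, x⟩
  · exact ⟨∅, by simp, by simp, inl_mem_bits y⟩
  · exact ⟨{i}, by simpa using inr_mem_bits.1 hβ, by simp, inr_mem_bits.2 (by simp)⟩

theorem agreeCfg_iff {c c' : TM2.Cfg Γ Λ σ} :
    AgreeCfg P c c' ↔ ∀ β ∈ bits Γ Λ σ P, CfgBit.val c β = CfgBit.val c' β := by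
  constructor
  · rintro h (y | ⟨i, x⟩) hβ
    · simp [CfgBit.val, h.l_eq, h.var_eq]
    · simp [CfgBit.val, h.agreeOn x.1 i (inr_mem_bits.1 hβ)]
  · intro h
    have control := h (.inl (c.l, c.var)) (inl_mem_bits _)
    obtain ⟨hl, hv⟩ : c'.l = c.l ∧ c'.var = c.var := by simpa [CfgBit.val] using control
    refine ⟨hl.symm, hv.symm, fun k i hi => Option.ext fun γ => ?_⟩
    simpa [CfgBit.val] using h (.inr (i, ⟨k, γ⟩)) (inr_mem_bits.2 hi)

variable {m : ℕ}

/-- The bits of the control and of the positions in `P` of configurations that depend on Boolean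
inputs. -/
noncomputable def bitFuns (c : (Fin m → Bool) → TM2.Cfg Γ Λ σ) (P : Finset ℕ) :
    List (BoolFun m) :=
  (bits Γ Λ σ P).toList.map fun β b => CfgBit.val (c b) β

variable {c : (Fin m → Bool) → TM2.Cfg Γ Λ σ}

theorem mem_bitFuns {f : BoolFun m} :
    f ∈ bitFuns c P ↔ ∃ β ∈ bits Γ Λ σ P, (fun b => CfgBit.val (c b) β) = f := by
  simp [bitFuns]

theorem bitFuns_mono (h : P ⊆ Q) : bitFuns c P ⊆ bitFuns c Q := fun f hf => by
  obtain ⟨β, hβ, rfl⟩ := mem_bitFuns.1 hf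
  exact mem_bitFuns.2 ⟨β, bits_mono h hβ, rfl⟩

theorem length_bitFuns : (bitFuns c P).length = (bits Γ Λ σ P).card := by
  simp [bitFuns]

theorem LocalGate.of_agreeCfg {d : ℕ} {L : List (BoolFun m)} {f : BoolFun m}
    (hL : bitFuns c P ⊆ L) (hd : (bits Γ Λ σ P).card ≤ d)
    (hf : ∀ b b', AgreeCfg P (c b) (c b') → f b = f b') : LocalGate d L f := by
  refine ⟨bitFuns c P, fun s hs => .inl (hL hs), length_bitFuns.trans_le hd, fun b b' h => ?_⟩
  refine hf b b' (agreeCfg_iff.2 fun β hβ => ?_)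
  exact List.map_inj_left.1 h _ (mem_bitFuns.2 ⟨β, hβ, rfl⟩)

variable [DecidableEq K] (M : Λ → TM2.Stmt Γ Λ σ)

theorem localGate_totalize_step {A R : ℕ} (hA : ∀ P, (bits Γ Λ σ P).card ≤ A * (P.card + 1))
    {f : BoolFun m} (hf : f ∈ bitFuns (fun b => totalize (TM2.step M) (c b)) (.range R)) :
    LocalGate (A * (3 * machineDepth M + 2))
      (bitFuns c (.range (R + machineDepth M))) f := by
  obtain ⟨β, hβ, rfl⟩ := mem_bitFuns.1 hf
  obtain ⟨P, hPR, hP, hβP⟩ := exists_mem_bits_of_card_le_one hβ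
  refine .of_agreeCfg (bitFuns_mono (window_subset_range hPR)) ((hA _).trans ?_) fun b b' h => ?_
  · exact Nat.mul_le_mul_left A (Nat.succ_le_succ (card_window_le hP))
  · exact agreeCfg_iff.1 (h.totalize_step M) β hβP

theorem LocalGate.mono_fanIn {d d' : ℕ} {L : List (BoolFun m)} {f : BoolFun m}
    (hf : LocalGate d L f) (h : d ≤ d') : LocalGate d' L f :=
  let ⟨S, hS, hd, hfS⟩ := hf
  ⟨S, hS, hd.trans h, hfS⟩

theorem exists_tableau : ∃ A d : ℕ, ∀ {m : ℕ} {c : (Fin m → Bool) → TM2.Cfg Γ Λ σ},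
    (∀ β, LocalGate 1 [] fun b => CfgBit.val (c b) β) → ∀ t R : ℕ, ∃ L, Chain (LocalGate d) L ∧
      bitFuns (fun b => (totalize (TM2.step M))^[t] (c b)) (.range R) ⊆ L ∧
      L.length ≤ (t + 1) * (A * (R + machineDepth M * t + 1)) := by
  obtain ⟨A, hA⟩ := exists_card_bits_le Γ Λ σ
  refine ⟨A, A * (3 * machineDepth M + 2) + 1, fun {m c} hc t => ?_⟩
  induction t with
  | zero =>
    refine fun R => ⟨bitFuns c (.range R), ?_, List.Subset.refl _, ?_⟩
    · refine Chain.nil.append fun f hf => ?_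
      obtain ⟨β, -, rfl⟩ := mem_bitFuns.1 hf
      exact (hc β).mono_fanIn (Nat.le_add_left _ _)
    · simpa [length_bitFuns] using hA (.range R)
  | succ t ih =>
    intro R
    obtain ⟨L, hL, row, L_length⟩ := ih (R + machineDepth M)
    refine ⟨L ++ bitFuns (fun b => (totalize (TM2.step M))^[t + 1] (c b)) (.range R),
      hL.append fun f hf => ?_, List.subset_append_right _ _, ?_⟩
    · simp only [Function.iterate_succ_apply'] at hf
      exact ((localGate_totalize_step M hA hf).mono row).mono_fanIn (Nat.le_succ _)
    · have row_card := hA (.range R)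
      rw [Finset.card_range] at row_card
      rw [List.length_append, length_bitFuns]
      calc L.length + (bits Γ Λ σ (.range R)).card
          ≤ (t + 1) * (A * (R + machineDepth M + machineDepth M * t + 1)) + A * (R + 1) := by
            gcongr
        _ ≤ (t + 1) * (A * (R + machineDepth M + machineDepth M * t + 1)) +
            A * (R + machineDepth M + machineDepth M * t + 1) := by gcongr; omega
        _ = (t + 1 + 1) * (A * (R + machineDepth M * (t + 1) + 1)) := by ring

end Tableau

/-! ### Functions in P applied to projections -/

section Projection

variable {m N N' : ℕ} {x y : (Fin m → Bool) → List Bool}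

/-- `x` is a projection of length `N`: each of the `N` entries of `x b` is either constant or the
value of a coordinate of `b`. -/
def IsProjection (N : ℕ) (x : (Fin m → Bool) → List Bool) : Prop :=
  ∃ src : List (Bool ⊕ Fin m), src.length = N ∧ x = fun b => src.map (Sum.elim id b)

theorem IsProjection.length_eq (hx : IsProjection N x) (b : Fin m → Bool) : (x b).length = N := by
  obtain ⟨src, rfl, rfl⟩ := hx
  exact List.length_map _

theorem isProjection_const (w : List Bool) :
    IsProjection w.length fun _ : Fin m → Bool => w :=
  ⟨w.map .inl, by simp, by simp⟩

theorem isProjection_ofFn {k : ℕ} (σ : Fin k → Fin m) :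
    IsProjection k fun b => List.ofFn (b ∘ σ) :=
  ⟨List.ofFn (.inr ∘ σ), by simp, by simp [List.map_ofFn, ← Function.comp_assoc]⟩

theorem IsProjection.pairing (hx : IsProjection N x) (hy : IsProjection N' y) :
    IsProjection (2 * N + 2 + N') fun b => pairing (x b) (y b) := by
  obtain ⟨s, rfl, rfl⟩ := hx
  obtain ⟨t, rfl, rfl⟩ := hy
  refine ⟨s.flatMap (fun z => [z, z]) ++ .inl true :: .inl false :: t, ?_, funext fun b => ?_⟩
  · simp only [List.length_append, List.length_flatMap, List.length_cons, List.length_nil,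
      List.map_const', List.sum_replicate, smul_eq_mul]
    ring
  · simp [InSeq.pairing, List.map_flatMap, List.flatMap_map]

theorem val_initList_congr {tm : FinTM2} {s s' : List (tm.Γ tm.k₀)} {i : ℕ}
    (h : s[i]? = s'[i]?) (x : Σ k, tm.Γ k) :
    CfgBit.val (initList tm s) (.inr (i, x)) = CfgBit.val (initList tm s') (.inr (i, x)) := by
  have stk_congr (k : tm.K) : ((initList tm s).stk k)[i]? = ((initList tm s').stk k)[i]? := by
    by_cases hk : k = tm.k₀
    · subst hk
      simpa [initList] using h
    · simp [initList, hk]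
  simp [CfgBit.val, stk_congr]

theorem IsProjection.localGate_initList (hx : IsProjection N x) (tm : FinTM2)
    (e : Bool → tm.Γ tm.k₀) (β : CfgBit tm.Γ tm.Λ tm.σ) :
    LocalGate 1 [] fun b => CfgBit.val (initList tm ((x b).map e)) β := by
  obtain ⟨src, -, rfl⟩ := hx
  rcases β with y | ⟨i, z⟩
  · exact localGate_const 1 [] (CfgBit.val (initList tm []) (.inl y))
  rcases hi : src[i]? with _ | x₀ | j
  · exact ⟨[], by simp, by simp, fun b b' _ => val_initList_congr (by simp [hi]) z⟩
  · exact ⟨[], by simp, by simp, fun b b' _ => val_initList_congr (by simp [hi]) z⟩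
  · refine ⟨[fun b => b j], by simpa [Avail] using ⟨j, rfl⟩, le_rfl, fun b b' h => ?_⟩
    have : b j = b' j := by simpa using h
    exact val_initList_congr (by simp [hi, this]) z

theorem exists_computes_of_mem_PTime {g : List Bool → Bool} (hg : g ∈ PTime) :
    ∃ p : Polynomial ℕ, ∀ {m N : ℕ} {x : (Fin m → Bool) → List Bool}, IsProjection N x →
      ∃ X ∈ ISbr, Computes X (fun b => g (x b)) ∧ X.length ≤ p.eval N := by
  obtain ⟨M, hM⟩ := hg
  let := M.tm.kFin
  let := M.tm.ΛFin
  let := M.tm.σFin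
  have (k : M.tm.K) : Fintype (M.tm.Γ k) := Fintype.ofFinite _
  obtain ⟨A, d, tableau⟩ := exists_tableau M.tm.m
  let D := machineDepth M.tm.m
  refine ⟨(M.time + 1) * (.C A * (1 + .C D * M.time + 1)) * .C (4 * 2 ^ d) + .C 3,
    fun {m N x} hx => ?_⟩
  obtain ⟨L, hL, row, L_length⟩ := tableau
    (hx.localGate_initList M.tm M.inputAlphabet.invFun) (M.time.eval N) 1
  obtain ⟨X, hX, X_computes, X_length⟩ := hL.exists_computes
    (row (mem_bitFuns.2 ⟨.inr (0, ⟨M.tm.k₁, M.outputAlphabet.invFun true⟩),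
      inr_mem_bits.2 (by simp), rfl⟩))
  refine ⟨X, hX, ?_, X_length.trans ?_⟩
  · convert X_computes using 2 with b
    have halts := M.outputsFun (x b)
    rw [hx.length_eq] at halts
    have final : (totalize (TM2.step M.tm.m))^[M.time.eval N]
        (initList M.tm ((x b).map M.inputAlphabet.invFun)) = _ :=
      iterate_totalize_of_evalsToInTime halts rfl
    rw [final, Bool.eq_iff_iff]
    simp [CfgBit.val, haltList, Computability.encodeBool]
  · simp only [Polynomial.eval_add, Polynomial.eval_mul, Polynomial.eval_C, Polynomial.eval_one]
    gcongr

end Projection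

/-! ### From NP/poly to NPLIS -/

theorem exists_computes_false (m : ℕ) :
    ∃ X ∈ ISbr, Computes X (fun _ : Fin m → Bool => false) ∧ X.length ≤ 1 :=
  ⟨[.halt], by simp [ISbr, Instr.Permitted],
    computes_iff.2 ⟨0, fun _ => by simp [Instr.step, State.outcome, env]⟩, le_rfl⟩

theorem exists_mem_PLIS_extending {ν : ℕ → ℕ} (hν : ν.Injective) {F : ∀ n, BoolFun (ν n)}
    {p : Polynomial ℕ}
    (hF : ∀ n, ∃ X ∈ ISbr, Computes X (F n) ∧ X.length ≤ p.eval (ν n)) :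
    ∃ g ∈ PLIS, ∀ n, g (ν n) = F n := by
  have extension (m : ℕ) : ∃ f : BoolFun m,
      (∃ X ∈ ISbr, Computes X f ∧ X.length ≤ (p + 1).eval m) ∧ ∀ n (h : ν n = m), f = h ▸ F n := by
    rw [Polynomial.eval_add, Polynomial.eval_one]
    by_cases hm : ∃ n, ν n = m
    · obtain ⟨n, rfl⟩ := hm
      obtain ⟨X, hX, hXF, X_length⟩ := hF n
      refine ⟨F n, ⟨X, hX, hXF, X_length.trans (Nat.le_succ _)⟩, fun n' h => ?_⟩
      obtain rfl := hν h
      rfl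
    · obtain ⟨X, hX, hXf, X_length⟩ := exists_computes_false m
      exact ⟨_, ⟨X, hX, hXf, X_length.trans (Nat.le_add_left _ _)⟩, fun n h => (hm ⟨n, h⟩).elim⟩
  choose g g_computes g_eq using extension
  exact ⟨g, ⟨_, mem_poly_iff.2 ⟨p + 1, fun _ => le_rfl⟩, g_computes⟩, fun n => g_eq _ n rfl⟩

theorem exists_list_iff_exists_fin {α : Type*} {k : ℕ} {P : List α → Prop} :
    (∃ c : List α, c.length = k ∧ P c) ↔ ∃ c : Fin k → α, P (List.ofFn c) := by
  constructor
  · rintro ⟨c, rfl, hc⟩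
    exact ⟨c.get, by rwa [List.ofFn_get]⟩
  · rintro ⟨c, hc⟩
    exact ⟨_, List.length_ofFn, hc⟩

theorem exists_comp_castLE_iff {α : Type*} [Nonempty α] {k h : ℕ} (hk : k ≤ h)
    {P : (Fin k → α) → Prop} : (∃ c : Fin h → α, P (c ∘ Fin.castLE hk)) ↔ ∃ c, P c :=
  (Fin.castLE_injective hk).surjective_comp_right.exists.symm

theorem length_pairing (w c : List Bool) : (pairing w c).length = 2 * w.length + 2 + c.length := by
  simp only [pairing, List.length_append, List.length_flatMap, List.length_cons, List.length_nil,
    List.map_const', List.sum_replicate, smul_eq_mul]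
  ring

/-- The check that `g` performs on the first `n` inputs, paired with the advice `a`, and the
certificate that consists of the next `k` inputs. The other inputs are ignored. -/
def checkWithAdvice (g : List Bool → Bool) (a : List Bool) {n k h : ℕ} (hk : k ≤ h) :
    BoolFun (n + h) :=
  fun b => g (pairing (pairing (List.ofFn (b ∘ Fin.castAdd h)) a)
    (List.ofFn (b ∘ Fin.natAdd n ∘ Fin.castLE hk)))

theorem checkWithAdvice_append (g : List Bool → Bool) (a : List Bool) {n k h : ℕ} (hk : k ≤ h)
    (w : Fin n → Bool) (c : Fin h → Bool) : checkWithAdvice g a hk (Fin.append w c) =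
      g (pairing (pairing (List.ofFn w) a) (List.ofFn (c ∘ Fin.castLE hk))) := by
  simp only [checkWithAdvice, Function.comp_def, Fin.append_left, Fin.append_right]

theorem exists_computes_checkWithAdvice {g : List Bool → Bool} (hg : g ∈ PTime) :
    ∃ p : Polynomial ℕ, ∀ (a : List Bool) {n k h : ℕ} (hk : k ≤ h), ∃ X ∈ ISbr,
      Computes X (checkWithAdvice g a hk : BoolFun (n + h)) ∧
        X.length ≤ p.eval (2 * (2 * n + 2 + a.length) + 2 + k) := by
  obtain ⟨p, hp⟩ := exists_computes_of_mem_PTime hg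
  exact ⟨p, fun a _ _ _ hk => hp
    (((isProjection_ofFn _).pairing (isProjection_const a)).pairing (isProjection_ofFn _))⟩

theorem NPpoly_subset : NPpoly ⊆ familyEquiv '' NPLIS := by
  rintro f ⟨g, ⟨p, g₀, hg₀, hg⟩, h', h'_poly, a, ha, hf⟩
  obtain ⟨r, hr⟩ := mem_poly_iff.1 h'_poly
  obtain ⟨P, hP⟩ := exists_computes_checkWithAdvice hg₀
  let Q : Polynomial ℕ := .C 2 * .X + .C 2 + r
  have pair_length (n : ℕ) : 2 * n + 2 + (a n).length ≤ Q.eval n := by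
    simpa [Q] using (ha n).trans (hr n)
  let h (n : ℕ) : ℕ := (p.comp Q).eval n
  have h_mono : Monotone h := eval_mono _
  have certificate_length (n : ℕ) : p.eval (2 * n + 2 + (a n).length) ≤ h n :=
    (eval_mono p (pair_length n)).trans_eq Polynomial.eval_comp.symm
  have check_computes (n : ℕ) : ∃ X ∈ ISbr,
      Computes X (checkWithAdvice g₀ (a n) (n := n) (certificate_length n)) ∧
        X.length ≤ (P.comp (.C 2 * Q + .C 2 + p.comp Q)).eval (n + h n) := by
    obtain ⟨X, hX, X_computes, X_length⟩ := hP (a n) (n := n) (certificate_length n)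
    refine ⟨X, hX, X_computes, X_length.trans ?_⟩
    rw [Polynomial.eval_comp]
    refine eval_mono P (le_trans ?_ (eval_mono _ (Nat.le_add_right n (h n))))
    have pair_length := pair_length n
    have certificate_length := certificate_length n
    simp only [Polynomial.eval_add, Polynomial.eval_mul, Polynomial.eval_C]
    gcongr
  have ν_mono : StrictMono fun n => n + h n := strictMono_id.add_monotone h_mono
  obtain ⟨G, hG, G_eq⟩ := exists_mem_PLIS_extending ν_mono.injective check_computes
  refine ⟨familyEquiv.symm f,
    ⟨h, mem_poly_iff.2 ⟨_, fun _ => le_rfl⟩, h_mono, G, hG, fun n w => ?_⟩,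
    familyEquiv.apply_symm_apply f⟩
  rw [show familyEquiv.symm f n w = f (List.ofFn w) from rfl, hf, hg, length_pairing,
    List.length_ofFn, exists_list_iff_exists_fin,
    ← exists_comp_castLE_iff (certificate_length n)]
  simp only [G_eq, checkWithAdvice_append]

/-! ### Reduction to NAND gates -/

section Nand

variable {m d n k : ℕ} {L : List (BoolFun m)} {f g s : BoolFun m}

/-- The gates of the chains that are evaluated on a tape: the constant `false` and the NAND of two
available functions. -/
inductive NandGate (L : List (BoolFun m)) : BoolFun m → Prop
  | const_false : NandGate L fun _ => false
  | nand {f g : BoolFun m} (hf : Avail L f) (hg : Avail L g) : NandGate L fun b => !(f b && g b)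

/-- Every chain of NAND gates that contains `L` can be extended by at most `n` gates so that `f`
becomes available. The quantification over all such chains makes the costs of the operands of a
gate add up. -/
def NandCost (n : ℕ) (L : List (BoolFun m)) (f : BoolFun m) : Prop :=
  ∀ K, L ⊆ K → Chain NandGate K →
    ∃ K', Chain NandGate K' ∧ K ⊆ K' ∧ K'.length ≤ K.length + n ∧ Avail K' f

theorem NandCost.mono (hf : NandCost n L f) (h : n ≤ k) : NandCost k L f := fun K hLK hK =>
  let ⟨K', hK', hKK', hlen, hav⟩ := hf K hLK hK
  ⟨K', hK', hKK', hlen.trans (by gcongr), hav⟩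

theorem Avail.nandCost (hf : Avail L f) : NandCost 0 L f := fun K hLK hK =>
  ⟨K, hK, List.Subset.refl K, le_rfl, hf.mono hLK⟩

theorem nandCost_const_false : NandCost 1 L fun _ => false := fun K _ hK =>
  ⟨_, hK.snoc .const_false, by simp, by simp, .inl (by simp)⟩

theorem NandCost.nand (hf : NandCost n L f) (hg : NandCost k L g) :
    NandCost (n + k + 1) L fun b => !(f b && g b) := by
  intro K hLK hK
  obtain ⟨K₁, hK₁, hKK₁, hlen₁, hf₁⟩ := hf K hLK hK
  obtain ⟨K₂, hK₂, hK₁K₂, hlen₂, hg₂⟩ := hg K₁ (List.Subset.trans hLK hKK₁) hK₁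
  refine ⟨_, hK₂.snoc (.nand (hf₁.mono hK₁K₂) hg₂), ?_, ?_, .inl (by simp)⟩
  · exact List.Subset.trans hKK₁ (List.subset_append_of_subset_left _ hK₁K₂)
  · rw [List.length_append, List.length_singleton]
    omega

theorem nandCost_const (x : Bool) : NandCost 3 L fun _ => x := by
  cases x
  · exact nandCost_const_false.mono (by norm_num)
  · exact nandCost_const_false.nand nandCost_const_false

theorem NandCost.ite (hs : Avail L s) (hf : NandCost n L f) (hg : NandCost k L g) :
    NandCost (n + k + 4) L fun b => if s b then f b else g b := by
  have not_s := hs.nandCost.nand hs.nandCost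
  convert ((hs.nandCost.nand hf).nand (not_s.nand hg)).mono (k := n + k + 4) (by omega) using 2
    with b
  cases s b <;> simp

theorem nandCost_comp_map {S : List (BoolFun m)} (hS : ∀ s ∈ S, Avail L s)
    (φ : List Bool → Bool) :
    NandCost (7 * 2 ^ S.length - 4) L fun b => φ (S.map fun s => s b) := by
  induction S generalizing φ with
  | nil => exact nandCost_const (φ [])
  | cons s S ih =>
    rw [List.forall_mem_cons] at hS
    have shannon : (fun b => φ ((s :: S).map fun s => s b)) = fun b =>
        if s b then φ (true :: S.map fun s => s b) else φ (false :: S.map fun s => s b) := by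
      funext b
      cases h : s b <;> simp [h]
    rw [shannon]
    refine (NandCost.ite hS.1 (ih hS.2 (φ ∘ List.cons true))
      (ih hS.2 (φ ∘ List.cons false))).mono ?_
    have : 1 ≤ 2 ^ S.length := Nat.one_le_two_pow
    rw [List.length_cons, pow_succ]
    omega

theorem LocalGate.nandCost (hf : LocalGate d L f) : NandCost (7 * 2 ^ d) L f := by
  obtain ⟨S, hS, hd, hfS⟩ := hf
  obtain ⟨φ, rfl⟩ := (Function.factorsThrough_iff f).1 hfS
  refine (nandCost_comp_map hS φ).mono ((Nat.sub_le _ _).trans ?_)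
  gcongr
  norm_num

theorem Chain.exists_nandChain (hL : Chain (LocalGate d) L) :
    ∃ K : List (BoolFun m), Chain NandGate K ∧ K.length ≤ 7 * 2 ^ d * L.length ∧
      ∀ f, Avail L f → Avail K f := by
  induction hL with
  | nil => exact ⟨[], .nil, le_rfl, fun f hf => hf⟩
  | @snoc L g _ hg ih =>
    obtain ⟨K, hK, hlen, hLK⟩ := ih
    obtain ⟨S, hS, hd, hgS⟩ := hg
    have hgK : LocalGate d K g := ⟨S, fun s hs => hLK s (hS s hs), hd, hgS⟩
    obtain ⟨K', hK', hKK', hlen', hgK'⟩ := hgK.nandCost K (List.Subset.refl K) hK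
    refine ⟨K', hK', ?_, ?_⟩
    · rw [List.length_append, List.length_singleton, mul_add_one]
      omega
    · rintro f (hf | ⟨i, rfl⟩)
      · rcases List.mem_append.1 hf with hf | hf
        · exact (hLK f (.inl hf)).mono hKK'
        · rwa [List.mem_singleton.1 hf]
      · exact .inr ⟨i, rfl⟩

end Nand

/-! ### Evaluating chains of NAND gates on a tape -/

/-- The commands of the universal verifier, which operates on an accumulator and on a tape that is
infinite in both directions. -/
inductive Command
  | left
  | right
  | and
  | store

/-- The effect of a command on the accumulator and on the contents of the tape, as a function of the
position relative to the head. Since `store` writes the negation of the accumulator and resets the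
accumulator to `true`, a NAND gate takes one `and` for each operand followed by a `store`. -/
def Command.exec : Command → Bool × (ℤ → Bool) → Bool × (ℤ → Bool)
  | .left, (a, τ) => (a, fun i => τ (i - 1))
  | .right, (a, τ) => (a, fun i => τ (i + 1))
  | .and, (a, τ) => (a && τ 0, τ)
  | .store, (a, τ) => (true, Function.update τ 0 !a)

/-- The effect of a program of the universal verifier. -/
def execute : List Command → Bool × (ℤ → Bool) → Bool × (ℤ → Bool)
  | [], s => s
  | c :: P, s => execute P (c.exec s)

theorem execute_append (P Q : List Command) (s : Bool × (ℤ → Bool)) :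
    execute (P ++ Q) s = execute Q (execute P s) := by
  induction P generalizing s with
  | nil => rfl
  | cons _ _ ih => exact ih _

/-- Moving the head by `q` cells, to the right if `q` is positive. -/
def walk (q : ℤ) : List Command :=
  List.replicate q.toNat .right ++ List.replicate (-q).toNat .left

/-- Performing `c` at the cell at distance `q` and returning. -/
def Command.atCell (q : ℤ) (c : Command) : List Command :=
  walk q ++ c :: walk (-q)

theorem Command.length_atCell (q : ℤ) (c : Command) :
    (c.atCell q).length = 2 * q.natAbs + 1 := by
  simp only [atCell, walk, List.length_append, List.length_cons, List.length_replicate]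
  omega

section Execute

variable (a : Bool) (τ : ℤ → Bool) (q : ℤ)

theorem execute_replicate_left (k : ℕ) :
    execute (List.replicate k .left) (a, τ) = (a, fun i => τ (i - k)) := by
  induction k generalizing τ with
  | zero => simp [execute]
  | succ k ih =>
    rw [List.replicate_succ, execute, Command.exec, ih]
    simp only [Nat.cast_succ, sub_sub]

theorem execute_replicate_right (k : ℕ) :
    execute (List.replicate k .right) (a, τ) = (a, fun i => τ (i + k)) := by
  induction k generalizing τ with
  | zero => simp [execute]
  | succ k ih =>
    rw [List.replicate_succ, execute, Command.exec, ih]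
    simp only [Nat.cast_succ, add_assoc]

theorem execute_walk : execute (walk q) (a, τ) = (a, fun i => τ (i + q)) := by
  rw [walk, execute_append, execute_replicate_right, execute_replicate_left]
  congr! 3
  omega

theorem execute_atCell_and : execute (Command.and.atCell q) (a, τ) = (a && τ q, τ) := by
  simp only [Command.atCell, execute_append, execute, execute_walk, Command.exec,
    zero_add, neg_add_cancel_right]

theorem execute_atCell_store :
    execute (Command.store.atCell q) (a, τ) = (true, Function.update τ q !a) := by
  simp only [Command.atCell, execute_append, execute, execute_walk, Command.exec]
  congr 1
  funext i
  simp [Function.update_apply, add_neg_eq_zero]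

end Execute

/-- The list `v` is written on the tape, from the cell at distance `o` to the left of the head. -/
def TapeHolds (o : ℕ) (v : List Bool) (τ : ℤ → Bool) : Prop :=
  ∀ (i : ℕ) (x : Bool), v[i]? = some x → τ (i - o) = x

theorem TapeHolds.of_prefix {o : ℕ} {v v' : List Bool} {τ : ℤ → Bool} (h : TapeHolds o v' τ)
    (hv : v <+: v') : TapeHolds o v τ := by
  obtain ⟨u, rfl⟩ := hv
  intro i x hx
  obtain ⟨hi, -⟩ := List.getElem?_eq_some_iff.1 hx
  exact h i x (by rwa [List.getElem?_append_left hi])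

theorem TapeHolds.snoc {o : ℕ} {v : List Bool} {τ : ℤ → Bool} (h : TapeHolds o v τ) (x : Bool) :
    TapeHolds o (v ++ [x]) (Function.update τ (v.length - o) x) := by
  intro i y hy
  rcases lt_trichotomy i v.length with hi | rfl | hi
  · rw [Function.update_of_ne (by omega)]
    exact h i y (by rwa [List.getElem?_append_left hi] at hy)
  · simpa using hy
  · obtain ⟨hi', -⟩ := List.getElem?_eq_some_iff.1 hy
    rw [List.length_append, List.length_singleton] at hi'
    omega

section Program

variable {m o : ℕ} {L : List (BoolFun m)} {f : BoolFun m}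

/-- The arguments followed by the values of the functions in `L`, as laid out on the tape. -/
def cells (L : List (BoolFun m)) (b : Fin m → Bool) : List Bool :=
  List.ofFn b ++ L.map fun f => f b

theorem length_cells (L : List (BoolFun m)) (b : Fin m → Bool) :
    (cells L b).length = m + L.length := by
  simp [cells]

theorem cells_snoc (L : List (BoolFun m)) (f : BoolFun m) (b : Fin m → Bool) :
    cells (L ++ [f]) b = cells L b ++ [f b] := by
  simp [cells]

theorem Avail.exists_cell (hf : Avail L f) :
    ∃ i < m + L.length, ∀ b, (cells L b)[i]? = some (f b) := by
  rcases hf with hf | ⟨i, rfl⟩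
  · obtain ⟨j, hj, rfl⟩ := List.getElem_of_mem hf
    exact ⟨m + j, by omega, fun b => by simp [cells, hj]⟩
  · exact ⟨i, by omega, fun b => by simp [cells, List.getElem?_append_left]⟩

theorem Avail.exists_cell_program (hf : Avail L f) (ho : o ≤ m) :
    ∃ P : List Command, P.length ≤ 2 * (m + L.length) + 1 ∧
      ∀ a b τ, TapeHolds o (cells L b) τ → execute P (a, τ) = (a && f b, τ) := by
  obtain ⟨i, hi, hf⟩ := hf.exists_cell
  refine ⟨Command.and.atCell (i - o), ?_, fun a b τ hτ => ?_⟩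
  · rw [Command.length_atCell]
    omega
  · rw [execute_atCell_and, hτ i _ (hf b)]

theorem exists_store_program (L : List (BoolFun m)) (ho : o ≤ m) :
    ∃ P : List Command, P.length ≤ 2 * (m + L.length) + 1 ∧
      ∀ a b τ, TapeHolds o (cells L b) τ →
        ∃ τ', execute P (a, τ) = (true, τ') ∧ TapeHolds o (cells L b ++ [!a]) τ' := by
  refine ⟨Command.store.atCell ((m + L.length : ℕ) - o), ?_, fun a b τ hτ =>
    ⟨_, execute_atCell_store _ _ _, ?_⟩⟩
  · rw [Command.length_atCell]
    omega
  · rw [← length_cells L b]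
    exact hτ.snoc _

theorem NandGate.exists_program (hf : NandGate L f) (ho : o ≤ m) :
    ∃ P : List Command, P.length ≤ 3 * (2 * (m + L.length) + 1) ∧
      ∀ b τ, TapeHolds o (cells L b) τ →
        ∃ τ', execute P (true, τ) = (true, τ') ∧ TapeHolds o (cells (L ++ [f]) b) τ' := by
  obtain ⟨R, R_length, hR⟩ := exists_store_program L ho
  simp only [cells_snoc]
  cases hf with
  | const_false => exact ⟨R, by omega, hR true⟩
  | nand hf hg =>
    obtain ⟨P, P_length, hP⟩ := hf.exists_cell_program ho
    obtain ⟨Q, Q_length, hQ⟩ := hg.exists_cell_program ho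
    refine ⟨P ++ Q ++ R, ?_, fun b τ hτ => ?_⟩
    · simp only [List.length_append]
      omega
    · simpa only [execute_append, hP _ b τ hτ, hQ _ b τ hτ, Bool.true_and] using hR _ b τ hτ

theorem Chain.exists_program (hL : Chain NandGate L) (ho : o ≤ m) :
    ∃ P : List Command, P.length ≤ L.length * (3 * (2 * (m + L.length) + 1)) ∧
      ∀ b τ, TapeHolds o (List.ofFn b) τ →
        ∃ τ', execute P (true, τ) = (true, τ') ∧ TapeHolds o (cells L b) τ' := by
  induction hL with
  | nil => exact ⟨[], by simp, fun b τ hτ => ⟨τ, rfl, by simpa [cells] using hτ⟩⟩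
  | @snoc L f _ hf ih =>
    obtain ⟨P, P_length, hP⟩ := ih
    obtain ⟨Q, Q_length, hQ⟩ := hf.exists_program ho
    refine ⟨P ++ Q, ?_, fun b τ hτ => ?_⟩
    · simp only [List.length_append, List.length_singleton]
      nlinarith
    · obtain ⟨τ', hPτ, hτ'⟩ := hP b τ hτ
      simpa only [execute_append, hPτ] using hQ b τ' hτ'

theorem Chain.exists_program_of_avail (hL : Chain NandGate L) (hf : Avail L f) (ho : o ≤ m) :
    ∃ P : List Command, P.length ≤ (L.length + 1) * (3 * (2 * (m + L.length) + 1)) ∧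
      ∀ b τ, TapeHolds o (List.ofFn b) τ → (execute P (true, τ)).1 = f b := by
  obtain ⟨P, P_length, hP⟩ := hL.exists_program ho
  obtain ⟨Q, Q_length, hQ⟩ := hf.exists_cell_program ho
  refine ⟨P ++ Q, ?_, fun b τ hτ => ?_⟩
  · rw [List.length_append, add_one_mul]
    omega
  · obtain ⟨τ', hPτ, hτ'⟩ := hP b τ hτ
    rw [execute_append, hPτ, hQ true b τ' hτ', Bool.true_and]

end Program

/-! ### The universal verifier -/

/-- The encoding of commands by two bits. -/
def Command.bits : Command → List Bool
  | .left => [false, false]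
  | .right => [false, true]
  | .and => [true, false]
  | .store => [true, true]

/-- The inverse of `Command.bits`. -/
def Command.ofBits : Bool → Bool → Command
  | false, false => .left
  | false, true => .right
  | true, false => .and
  | true, true => .store

/-- The program encoded by a list of bits, of which an odd last bit is ignored. -/
def decode : List Bool → List Command
  | x :: y :: p => Command.ofBits x y :: decode p
  | _ => []

theorem decode_flatMap_bits (P : List Command) : decode (P.flatMap Command.bits) = P := by
  induction P with
  | nil => rfl
  | cons c P ih => cases c <;> simpa [Command.bits, decode, Command.ofBits] using ih

theorem length_flatMap_bits (P : List Command) :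
    (P.flatMap Command.bits).length = 2 * P.length := by
  induction P with
  | nil => rfl
  | cons c P ih =>
    rw [List.flatMap_cons, List.length_append, ih, List.length_cons]
    cases c <;> simp only [Command.bits, List.length_cons, List.length_nil] <;> omega

/-- Inverts `pairing` in the second argument: pushes the first component onto `l`, in reverse order,
and also returns the second component. -/
def unpair : List Bool → List Bool → List Bool × List Bool
  | l, a :: b :: r => if a = b then unpair (a :: l) r else (l, r)
  | l, _ => (l, [])

theorem unpair_pairing (l w c : List Bool) : unpair l (pairing w c) = (w.reverse ++ l, c) := by
  induction w generalizing l with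
  | nil => rfl
  | cons x w ih => simpa [pairing, unpair] using ih (x :: l)

theorem length_unpair (l r : List Bool) :
    (unpair l r).1.length + (unpair l r).2.length ≤ l.length + r.length := by
  induction l, r using unpair.induct with
  | case1 l a r ih =>
    rw [unpair, if_pos rfl]
    simp only [List.length_cons] at ih ⊢
    omega
  | case2 l a b r h =>
    rw [unpair, if_neg h]
    simp only [List.length_cons]
    omega
  | case3 r l h =>
    rw [unpair]
    · simp only [List.length_nil]
      omega
    · exact h

/-- The function computed by the universal verifier: it runs the program encoded by the advice on a
tape with the input to the left of the head and the certificate to the right. -/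
def verify (x : List Bool) : Bool :=
  let (u, c) := unpair [] x
  let (w, a) := unpair [] u.reverse
  (execute (decode a) (true, (Tape.mk₂ w c).nth)).1

theorem verify_pairing (w a c : List Bool) : verify (pairing (pairing w a) c) =
    (execute (decode a) (true, (Tape.mk₂ w.reverse c).nth)).1 := by
  simp only [verify, unpair_pairing, List.append_nil, List.reverse_reverse]

/-! ### The universal verifier as a multi-stack machine -/

/-- The stacks of the universal verifier. The tape consists of `left` and `right`, and `prog` holds
the program. -/
inductive VerifierStack
  | left
  | right
  | prog
deriving DecidableEq

instance : Fintype VerifierStack := ⟨{.left, .right, .prog}, fun k => by cases k <;> decide⟩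

/-- The labels of the universal verifier, one for each phase of its computation. -/
inductive VerifierLabel
  | outer
  | flip
  | inner
  | perform
  | drain
deriving DecidableEq

instance : Fintype VerifierLabel :=
  ⟨{.outer, .flip, .inner, .perform, .drain}, fun φ => by cases φ <;> decide⟩

/-- The internal states of the universal verifier: the accumulator and two popped bits. -/
abbrev VerifierState := Bool × Option Bool × Option Bool

/-- The statements of the universal verifier. -/
abbrev VerifierStmt := TM2.Stmt (fun _ : VerifierStack => Bool) VerifierLabel VerifierState

/-- The configurations of the universal verifier. -/
abbrev VerifierCfg := TM2.Cfg (fun _ : VerifierStack => Bool) VerifierLabel VerifierState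

namespace VerifierStmt

open TM2.Stmt

/-- Forgets the popped bits and starts the phase `φ`. -/
def enter (φ : VerifierLabel) : VerifierStmt :=
  load (fun v => (v.1, none, none)) <| goto fun _ => φ

/-- Pops two bits of the stack `k`. -/
def popTwo (k : VerifierStack) (q : VerifierStmt) : VerifierStmt :=
  pop k (fun v x => (v.1, x, none)) <| pop k (fun v y => (v.1, v.2.1, y)) q

/-- One step of `unpair` from the stack `k` to the stack `left`, in the phase `φ`, which is followed
by the phase `ψ`. -/
def unpairStep (k : VerifierStack) (φ ψ : VerifierLabel) : VerifierStmt :=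
  popTwo k <| branch (fun v => v.2.2.isSome && v.2.1 == v.2.2)
    (push .left (fun v => v.2.1.getD default) <| enter φ) (enter ψ)

/-- The execution of a command. -/
def command : Command → VerifierStmt
  | .left =>
    pop .left (fun v x => (v.1, x, none)) <| push .right (fun v => v.2.1.getD default) <|
      enter .perform
  | .right =>
    pop .right (fun v x => (v.1, x, none)) <| push .left (fun v => v.2.1.getD default) <|
      enter .perform
  | .and => peek .right (fun v x => (v.1 && x.getD default, none, none)) <| enter .perform
  | .store =>
    pop .right (fun v _ => v) <| push .right (fun v => !v.1) <|
      load (fun _ => (true, none, none)) <| enter .perform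

end VerifierStmt

open TM2.Stmt VerifierStmt in
/-- The program of the universal verifier. -/
def verifierProgram : VerifierLabel → VerifierStmt
  | .outer => unpairStep .right .outer .flip
  | .flip =>
    pop .left (fun v x => (v.1, x, none)) <| branch (fun v => v.2.1.isSome)
      (push .prog (fun v => v.2.1.getD default) <| enter .flip) (enter .inner)
  | .inner => unpairStep .prog .inner .perform
  | .perform =>
    popTwo .prog <| branch (fun v => v.2.2.isSome)
      (branch (fun v => v.2.1 == some true)
        (branch (fun v => v.2.2 == some true) (command .store) (command .and))
        (branch (fun v => v.2.2 == some true) (command .right) (command .left)))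
      (enter .drain)
  | .drain =>
    pop .left (fun v x => (v.1, x, none)) <| pop .right (fun v y => (v.1, v.2.1, y)) <|
      branch (fun v => v.2.1.isSome || v.2.2.isSome)
        (enter .drain) (push .prog (fun v => v.1) <| load (fun _ => (true, none, none)) halt)

/-- The universal verifier. -/
def verifier : FinTM2 where
  K := VerifierStack
  k₀ := .right
  k₁ := .prog
  Γ _ := Bool
  Λ := VerifierLabel
  main := .outer
  σ := VerifierState
  initialState := (true, none, none)
  Γk₀Fin := inferInstanceAs (Fintype Bool)
  m := verifierProgram

section Contents

variable (l r p x : List Bool)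

/-- The stacks of the universal verifier with contents `l`, `r` and `p`. -/
@[simp]
def contents (l r p : List Bool) : VerifierStack → List Bool
  | .left => l
  | .right => r
  | .prog => p

@[simp]
theorem update_contents_left : Function.update (contents l r p) .left x = contents x r p := by
  funext k; cases k <;> rfl

@[simp]
theorem update_contents_right : Function.update (contents l r p) .right x = contents l x p := by
  funext k; cases k <;> rfl

@[simp]
theorem update_contents_prog : Function.update (contents l r p) .prog x = contents l r x := by
  funext k; cases k <;> rfl

end Contents

/-- The configuration at the start of a step in the phase `φ`, with accumulator `a` and stacks `S`,
when no popped bits are remembered. -/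
def phaseCfg (φ : VerifierLabel) (a : Bool) (S : VerifierStack → List Bool) : VerifierCfg :=
  ⟨some φ, (a, none, none), S⟩

@[simp]
theorem stepAux_enter (φ : VerifierLabel) (v : VerifierState) (S : VerifierStack → List Bool) :
    TM2.stepAux (VerifierStmt.enter φ) v S = phaseCfg φ v.1 S :=
  rfl

@[simp]
theorem stepAux_popTwo (k : VerifierStack) (q : VerifierStmt) (v : VerifierState)
    (S : VerifierStack → List Bool) :
    TM2.stepAux (VerifierStmt.popTwo k q) v S = TM2.stepAux q (v.1, (S k).head?, (S k).tail.head?)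
      (Function.update S k (S k).tail.tail) := by
  simp only [VerifierStmt.popTwo, TM2.stepAux, Function.update_self, Function.update_idem]

theorem initList_verifier (x : List Bool) :
    initList verifier x = phaseCfg .outer true (contents [] x []) := by
  simp only [initList, phaseCfg]
  congr 1
  funext k
  cases k <;> rfl

theorem haltList_verifier (a : Bool) :
    haltList verifier [a] = ⟨none, (true, none, none), contents [] [] [a]⟩ := by
  simp only [haltList]
  congr 1
  funext k
  cases k <;> rfl

/-- The universal verifier gets from `c` to `c'` in at most `n` steps. -/
def Reaches (n : ℕ) (c c' : VerifierCfg) : Prop :=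
  Nonempty (StateTransition.EvalsToInTime (TM2.step verifierProgram) c (some c') n)

theorem Reaches.trans {n n' : ℕ} {c c' c'' : VerifierCfg} (h : Reaches n c c')
    (h' : Reaches n' c' c'') : Reaches (n' + n) c c'' :=
  let ⟨e⟩ := h
  let ⟨e'⟩ := h'
  ⟨.trans _ _ _ _ _ _ e e'⟩

theorem Reaches.mono {n n' : ℕ} {c c' : VerifierCfg} (h : Reaches n c c') (hn : n ≤ n') :
    Reaches n' c c' :=
  let ⟨e⟩ := h
  ⟨⟨e.toEvalsTo, e.steps_le_m.trans hn⟩⟩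

theorem reaches_one {φ : VerifierLabel} {a : Bool} {S : VerifierStack → List Bool} {c : VerifierCfg}
    (h : TM2.stepAux (verifierProgram φ) (a, none, none) S = c) : Reaches 1 (phaseCfg φ a S) c :=
  ⟨⟨⟨1, congrArg some h⟩, le_rfl⟩⟩

theorem reaches_unpair {φ ψ : VerifierLabel} {k : VerifierStack}
    {S : List Bool → List Bool → VerifierStack → List Bool}
    (hφ : verifierProgram φ = .unpairStep k φ ψ) (hk : ∀ l r, S l r k = r)
    (hleft : ∀ l r, S l r .left = l) (update_k : ∀ l r x, Function.update (S l r) k x = S l x)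
    (update_left : ∀ l r x, Function.update (S l r) .left x = S x r) (a : Bool) (l r : List Bool) :
    Reaches (r.length + 1) (phaseCfg φ a (S l r))
      (phaseCfg ψ a (S (unpair l r).1 (unpair l r).2)) := by
  induction l, r using unpair.induct with
  | case1 l x r ih =>
    rw [unpair, if_pos rfl]
    refine ((reaches_one ?_).trans ih).mono (by simp)
    simp [hφ, VerifierStmt.unpairStep, hk, hleft, update_k, update_left]
  | case2 l x y r h =>
    rw [unpair, if_neg h]
    refine (reaches_one ?_).mono (Nat.le_add_left 1 _)
    simp [hφ, VerifierStmt.unpairStep, hk, update_k, beq_false_of_ne h]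
  | case3 r l h =>
    refine (reaches_one ?_).mono (Nat.le_add_left 1 _)
    rcases r with _ | ⟨x, _ | ⟨y, r⟩⟩
    · simp [hφ, VerifierStmt.unpairStep, hk, update_k, unpair]
    · simp [hφ, VerifierStmt.unpairStep, hk, update_k, unpair]
    · exact absurd rfl (h x y r)

theorem reaches_flip (a : Bool) (l r p : List Bool) :
    Reaches (l.length + 1) (phaseCfg .flip a (contents l r p))
      (phaseCfg .inner a (contents [] r (l.reverse ++ p))) := by
  induction l generalizing p with
  | nil => exact reaches_one (by simp [verifierProgram])
  | cons x l ih =>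
    rw [List.reverse_cons, List.append_assoc]
    exact (reaches_one (by simp [verifierProgram])).trans (ih (x :: p))

theorem exists_stepAux_command (k : Command) (a : Bool) (v : Option Bool × Option Bool)
    (l r p : List Bool) : ∃ l' r' : List Bool, l'.length + r'.length ≤ l.length + r.length + 1 ∧
      TM2.stepAux (VerifierStmt.command k) (a, v) (contents l r p) =
        phaseCfg .perform (k.exec (a, (Tape.mk₂ l r).nth)).1 (contents l' r' p) ∧
      (Tape.mk₂ l' r').nth = (k.exec (a, (Tape.mk₂ l r).nth)).2 := by
  cases k with
  | left =>
    refine ⟨l.tail, l.headI :: r, ?_, ?_, ?_⟩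
    · simp only [List.length_tail, List.length_cons]
      omega
    · cases l <;> simp [VerifierStmt.command, Command.exec]
    · funext i
      simp [Command.exec, Tape.mk₂, ← Tape.move_left_nth]
  | right =>
    refine ⟨r.headI :: l, r.tail, ?_, ?_, ?_⟩
    · simp only [List.length_tail, List.length_cons]
      omega
    · cases r <;> simp [VerifierStmt.command, Command.exec]
    · funext i
      simp [Command.exec, Tape.mk₂, ← Tape.move_right_nth]
  | and =>
    refine ⟨l, r, by omega, ?_, rfl⟩
    cases r <;> simp [VerifierStmt.command, Command.exec, Tape.mk₂]
  | store =>
    refine ⟨l, (!a) :: r.tail, ?_, ?_, ?_⟩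
    · simp only [List.length_tail, List.length_cons]
      omega
    · simp [VerifierStmt.command, Command.exec]
    · funext i
      simp [Command.exec, Tape.mk₂, Function.update_apply, ← Tape.write_nth]

theorem stepAux_perform (a x y : Bool) (l r p : List Bool) :
    TM2.stepAux (verifierProgram .perform) (a, none, none) (contents l r (x :: y :: p)) =
      TM2.stepAux (VerifierStmt.command (.ofBits x y)) (a, some x, some y) (contents l r p) := by
  cases x <;> cases y <;> simp [verifierProgram, Command.ofBits]

theorem exists_reaches_drain (a : Bool) (l r p : List Bool) :
    ∃ l' r', l'.length + r'.length ≤ l.length + r.length + p.length ∧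
      Reaches (p.length + 1) (phaseCfg .perform a (contents l r p))
        (phaseCfg .drain (execute (decode p) (a, (Tape.mk₂ l r).nth)).1 (contents l' r' [])) := by
  induction p using decode.induct generalizing a l r with
  | case1 x y p ih =>
    obtain ⟨l₁, r₁, length₁, step, tape⟩ :=
      exists_stepAux_command (.ofBits x y) a (some x, some y) l r p
    obtain ⟨l₂, r₂, length₂, reaches⟩ := ih _ l₁ r₁
    rw [tape, Prod.mk.eta] at reaches
    refine ⟨l₂, r₂, ?_, ?_⟩
    · simp only [List.length_cons]
      omega
    · rw [decode, execute]
      exact ((reaches_one ((stepAux_perform ..).trans step)).trans reaches).mono (by simp)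
  | case2 p h =>
    refine ⟨l, r, Nat.le_add_right _ _, (reaches_one ?_).mono (Nat.le_add_left 1 _)⟩
    rcases p with _ | ⟨x, _ | ⟨y, p⟩⟩
    · simp [verifierProgram, decode, execute]
    · simp [verifierProgram, decode, execute]
    · exact absurd rfl (h x y p)

theorem reaches_halt (a : Bool) {n : ℕ} {l r : List Bool} (hl : l.length ≤ n)
    (hr : r.length ≤ n) : Reaches (n + 1) (phaseCfg .drain a (contents l r []))
      ⟨none, (true, none, none), contents [] [] [a]⟩ := by
  induction n generalizing l r with
  | zero =>
    obtain rfl := List.eq_nil_of_length_eq_zero (Nat.le_zero.1 hl)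
    obtain rfl := List.eq_nil_of_length_eq_zero (Nat.le_zero.1 hr)
    exact reaches_one (by simp [verifierProgram])
  | succ n ih =>
    by_cases h : l = [] ∧ r = []
    · obtain ⟨rfl, rfl⟩ := h
      exact (ih (l := []) (r := []) (Nat.zero_le n) (Nat.zero_le n)).mono (Nat.le_succ _)
    · refine (reaches_one ?_).trans (ih (l := l.tail) (r := r.tail) ?_ ?_)
      · rcases l with _ | ⟨x, l⟩ <;> rcases r with _ | ⟨y, r⟩ <;> simp_all [verifierProgram]
      · simpa using hl
      · simpa using hr

theorem reaches_verify (x : List Bool) :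
    Reaches (5 * x.length + 5) (phaseCfg .outer true (contents [] x []))
      ⟨none, (true, none, none), contents [] [] [verify x]⟩ := by
  obtain ⟨u, c, unpair_x⟩ : ∃ u c, unpair [] x = (u, c) := ⟨_, _, rfl⟩
  obtain ⟨w, a, unpair_u⟩ : ∃ w a, unpair [] u.reverse = (w, a) := ⟨_, _, rfl⟩
  have outer := reaches_unpair (φ := .outer) (ψ := .flip) (k := .right)
    (S := fun l r => contents l r []) rfl (fun _ _ => rfl) (fun _ _ => rfl)
    (fun _ _ _ => update_contents_right ..) (fun _ _ _ => update_contents_left ..) true [] x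
  have flip := reaches_flip true u c []
  have inner := reaches_unpair (φ := .inner) (ψ := .perform) (k := .prog)
    (S := fun l p => contents l c p) rfl (fun _ _ => rfl) (fun _ _ => rfl)
    (fun _ _ _ => update_contents_prog ..) (fun _ _ _ => update_contents_left ..) true [] u.reverse
  obtain ⟨l, r, length_le, perform⟩ := exists_reaches_drain true w c a
  have halt := reaches_halt (execute (decode a) (true, (Tape.mk₂ w c).nth)).1
    (Nat.le_add_right l.length r.length) (Nat.le_add_left r.length l.length)
  have length_x := length_unpair [] x
  have length_u := length_unpair [] u.reverse
  simp only [unpair_x, unpair_u, List.append_nil, List.length_nil, List.length_reverse]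
    at outer flip inner length_x length_u
  simp only [verify, unpair_x, unpair_u]
  exact ((((outer.trans flip).trans inner).trans perform).trans halt).mono (by omega)

theorem verify_mem_PTime : verify ∈ PTime := by
  set time : Polynomial ℕ := Polynomial.C 5 * Polynomial.X + Polynomial.C 5 with time_eq
  have outputs (x y : List Bool) (hy : y = x) :
      Nonempty (TM2OutputsInTime verifier y (some [verify x]) (time.eval x.length)) := by
    have eval_time : time.eval x.length = 5 * x.length + 5 := by simp [time_eq]
    simp only [hy, eval_time, TM2OutputsInTime, Option.map_some, initList_verifier,
      haltList_verifier]
    exact reaches_verify x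
  exact ⟨{  tm := verifier
            inputAlphabet := .refl Bool
            outputAlphabet := .refl Bool
            time := time
            outputsFun := fun x => (outputs x _ (List.map_id x)).some },
    fun _ => (inferInstance : Finite Bool)⟩

theorem Computes.exists_program {m o : ℕ} {X : List Instr} {f : (Fin m → Bool) → Bool}
    (hX : Computes X f) (ho : o ≤ m) :
    ∃ P : List Command, P.length ≤ (168 * X.length + 113) * (6 * (m + 168 * X.length + 112) + 3) ∧
      ∀ b τ, TapeHolds o (List.ofFn b) τ → (execute P (true, τ)).1 = f b := by
  obtain ⟨L, chain, length_L, avail⟩ := hX.exists_chain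
  obtain ⟨K, nandChain, length_K, avail_of_avail⟩ := chain.exists_nandChain
  obtain ⟨P, length_P, execute_P⟩ := nandChain.exists_program_of_avail (avail_of_avail f avail) ho
  refine ⟨P, length_P.trans ?_, execute_P⟩
  have : K.length ≤ 168 * X.length + 112 := by
    rw [length_L] at length_K
    omega
  exact Nat.mul_le_mul (by omega) (by omega)

theorem tapeHolds_mk₂ (w c : List Bool) :
    TapeHolds w.length (w ++ c) (Tape.mk₂ w.reverse c).nth := by
  induction w using List.reverseRecOn generalizing c with
  | nil =>
    intro i x hx
    rw [List.length_nil, Nat.cast_zero, sub_zero, List.reverse_nil, Tape.mk₂, Tape.mk'_nth_nat,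
      ListBlank.nth_mk, List.getI_eq_getElem?_getD, ← List.nil_append c, hx, Option.getD_some]
  | append_singleton w y ih =>
    have move : (Tape.mk₂ (w ++ [y]).reverse c) = (Tape.mk₂ w.reverse (y :: c)).move .right := by
      simp [Tape.mk₂]
    intro i x hx
    rw [← ih (y :: c) i x (by simpa using hx), move, Tape.move_right_nth,
      List.length_append, List.length_singleton, Nat.cast_add, Nat.cast_one, sub_add_eq_sub_sub,
      sub_add_cancel]

theorem ofFn_append_prefix {α : Type*} {h k : ℕ} (hk : k ≤ h) (w : List α) (c : Fin h → α) :
    List.ofFn (Fin.append w.get (c ∘ Fin.castLE hk)) <+: w ++ List.ofFn c := by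
  rw [List.ofFn_fin_append, List.ofFn_get, List.prefix_append_right_inj]
  exact Fin.ofFn_take_eq_take_ofFn hk c ▸ List.take_prefix ..

theorem exists_programs_of_mem_PLIS {g : BoolFamily} (hg : g ∈ PLIS) {h : ℕ → ℕ} (hh : h ∈ poly) :
    ∃ P : ℕ → List Command, (∃ p : Polynomial ℕ, ∀ n, (P n).length ≤ p.eval n) ∧
      ∀ n b τ, TapeHolds n (List.ofFn b) τ → (execute (P n) (true, τ)).1 = g (n + h n) b := by
  obtain ⟨s, s_mem, hg⟩ := hg
  obtain ⟨p, h_le⟩ := mem_poly_iff.1 hh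
  obtain ⟨q, s_le⟩ := mem_poly_iff.1 s_mem
  choose X _ X_computes length_X using hg
  choose P length_P execute_P using fun n => (X_computes (n + h n)).exists_program le_self_add
  let M : Polynomial ℕ := Polynomial.X + p
  let S : Polynomial ℕ := 168 * q.comp M
  refine ⟨P, ⟨(S + 113) * (6 * (M + S + 112) + 3), fun n => (length_P n).trans ?_⟩, execute_P⟩
  have arity_le : n + h n ≤ M.eval n := by simpa [M] using h_le n
  have length_X_le : 168 * (X (n + h n)).length ≤ S.eval n := by
    simpa [S] using (length_X _).trans ((s_le _).trans (eval_mono q arity_le))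
  simp only [Polynomial.eval_mul, Polynomial.eval_add, Polynomial.eval_ofNat]
  gcongr

theorem NPLIS_subset : familyEquiv '' NPLIS ⊆ NPpoly := by
  classical
  rintro _ ⟨F, ⟨h, h_mem, -, g, g_mem, F_iff⟩, rfl⟩
  obtain ⟨p, h_le⟩ := mem_poly_iff.1 h_mem
  obtain ⟨P, ⟨q, length_P⟩, execute_P⟩ := exists_programs_of_mem_PLIS g_mem h_mem
  let advice (n : ℕ) : List Bool := (P n).flatMap Command.bits
  have advice_poly : (fun n => (advice n).length) ∈ poly :=
    mem_poly_iff.2 ⟨2 * q, fun n => by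
      simpa only [advice, length_flatMap_bits, Polynomial.eval_mul, Polynomial.eval_ofNat]
        using Nat.mul_le_mul_left 2 (length_P n)⟩
  refine ⟨fun x => decide (∃ c : List Bool, c.length = p.eval x.length ∧
      verify (pairing x c) = true), ⟨p, verify, verify_mem_PTime, fun x => decide_eq_true_iff⟩,
    _, advice_poly, advice, fun n => le_rfl, fun w => ?_⟩
  have certificate_length : h w.length ≤ p.eval (pairing w (advice w.length)).length :=
    (h_le _).trans (eval_mono p (by rw [length_pairing]; omega))
  rw [Bool.eq_iff_iff, decide_eq_true_iff, exists_list_iff_exists_fin, show familyEquiv F w =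
    F w.length w.get from rfl, F_iff, ← exists_comp_castLE_iff certificate_length]
  refine exists_congr fun c => ?_
  rw [verify_pairing, decode_flatMap_bits, execute_P _ _ _
    ((tapeHolds_mk₂ w _).of_prefix (ofFn_append_prefix certificate_length w c))]

end InSeq

/-- Under the identification of Boolean function families with functions on bit strings, NPLIS
coincides with NP/poly. -/
theorem mainTheorem2 : InSeq.familyEquiv '' InSeq.NPLIS = InSeq.NPpoly :=
  Set.Subset.antisymm InSeq.NPLIS_subset InSeq.NPpoly_subset
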